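/- For real $y$ let $\pi(y)$ denote the number of primes $p\le y$. Let $\lambda$ be a real number with $\frac{1}{33}<\lambda<\frac{1}{29}$ and put $\alpha=\frac{1-\lambda}{2}$. Then for every $\varepsilon'>0$ there is a real number $x_0$ (depending on $\lambda$ and $\varepsilon'$) such that for all real $x\ge x_0$ $$\sum_{1\le n\le x^{\alpha}}\left\{\pi\left(\frac{x+x^{\alpha}}{n}\right)-\pi\left(\frac{x}{n}\right)\right\}\ \ge\ \left(\frac14+\frac{\lambda}{2}-\varepsilon'\right)x^{\alpha},$$ where the sum is over positive integers $n$. -/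

import Mathlib

/-- The prime counting function at a real argument: the number of primes `p ≤ y`. -/
noncomputable def primePi (y : ℝ) : ℕ := Nat.primeCounting ⌊y⌋₊

/-! Put y = x^α and compute Σ log m over x < m ≤ x + y in Chebyshev's manner. The sum is y log x +
O(y) from below, and log m = Σ_{q ∣ m} Λ(q). The q ≤ y give at most y log y + O(y) = α y log x +
O(y). Proper prime powers q > y force m to have a large square divisor, which is rare. There remain
the primes q > y, written m = nq.

If n ≤ y, the pair is counted by the sum T of the theorem, with weight at most log(x + y). If n > y,
then q < (x + y)/y, the weight drops to about (1 - α) log x, and n runs through y < n < (x + y)/y, a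
range whose harmonic sum is about λ log x. Let M count these pairs. Then (1 - α) y log x ≤ T log x +
(1 - α) M log x, up to O(y + T).

M is bounded by Selberg's sieve of level R = x^(1/14), applied on average over n: the main term is y
· λ log x / (log x / 14) = 14 λ y. The remainders are sawtooth sums Σ_n ψ(z/n) with n near √x and z
= x/d or z = (x + y)/d, d ≤ R². They are O(x^0.337) on each dyadic block, by Fourier expansion and
the second difference test for exponential sums, and 1/7 + 0.337 < 14/29 < α.

With 1 - α = (1 + λ)/2 this gives T ≥ y ((1 + λ)/2 - 7λ(1 + λ)) + O(y / log x). Since 7λ(1 + λ) <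
1/4 for 0 < λ < 1/29, the coefficient exceeds 1/4 + λ/2.

The carrying lemmas are `sub_one_mul_log_le` (the Chebyshev argument), `sum_card_primes_le` (the
sieve), `exists_abs_sum_sawtooth_div_le` (the remainders) and `exists_sum_card_primes_middle_le`
(the bound for M). -/

/-! ### Selberg's optimal weights: normalisation, size, and the value of the quadratic form. -/

section SelbergWeights

open Finset ArithmeticFunction
open scoped ArithmeticFunction.Moebius ArithmeticFunction.zeta

/-- The denominator `∑_{l ≤ R} μ(l)² / φ(l)` of Selberg's sieve. -/
noncomputable def selbergDenom (R : ℕ) : ℝ :=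
  ∑ l ∈ Icc 1 R, (μ l : ℝ) ^ 2 / (Nat.totient l : ℝ)

/-- Selberg's optimal sieve weights of level `R` for the density `1 / d`. -/
noncomputable def selbergWeight (R d : ℕ) : ℝ :=
  d * ∑ l ∈ Icc 1 R with d ∣ l,
    (μ (l / d) : ℝ) * ((μ l : ℝ) / (Nat.totient l * selbergDenom R))

/-- An n with radical l is l·m with m composed of primes dividing l, and the Euler product of Σ 1/m
over all such m is l/φ(l). -/
theorem sum_inv_le_of_primeFactors_prod_eq (l R : ℕ) (hl : Squarefree l) :
    ∑ n ∈ Icc 1 R with ∏ p ∈ n.primeFactors, p = l, (1 : ℝ) / n ≤ 1 / Nat.totient l := by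
  have hl0 : l ≠ 0 := hl.ne_zero
  let f : ℕ →* ℝ :=
    { toFun := fun n => ((n : ℝ))⁻¹, map_one' := by simp, map_mul' := by intro a b; simp [mul_comm] }
  have hf : ∀ n, f n = (n : ℝ)⁻¹ := fun n => rfl
  have hlt : ∀ {p : ℕ}, p.Prime → ‖f p‖ < 1 := by
    intro p hp
    have : (1 : ℝ) < p := by exact_mod_cast hp.one_lt
    rw [hf, Real.norm_of_nonneg (by positivity)]
    exact inv_lt_one_of_one_lt₀ this
  obtain ⟨-, hs⟩ :=
    EulerProduct.summable_and_hasSum_factoredNumbers_prod_filter_prime_geometric hlt l.primeFactors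
  have hprod : ∏ p ∈ l.primeFactors with p.Prime, (1 - f p)⁻¹ = (l : ℝ) / Nat.totient l := by
    rw [filter_true_of_mem (fun p hp => Nat.prime_of_mem_primeFactors hp)]
    have h1 := Nat.totient_eq_mul_prod_factors l
    have h2 : (Nat.totient l : ℝ) = l * ∏ p ∈ l.primeFactors, (1 - (p : ℝ)⁻¹) := by
      have := congrArg (fun q : ℚ => (q : ℝ)) h1
      push_cast at this
      exact this
    have h3 : (l : ℝ) ≠ 0 := by exact_mod_cast hl0
    have h4 : (Nat.totient l : ℝ) ≠ 0 := by
      exact_mod_cast (Nat.totient_pos.2 (Nat.pos_of_ne_zero hl0)).ne'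
    rw [prod_inv_distrib]
    simp only [hf]
    rw [h2] at h4 ⊢
    have h5 := right_ne_zero_of_mul h4
    field_simp
  rw [hprod] at hs
  have hsub : ∀ n ∈ (Icc 1 R).filter (fun n => ∏ p ∈ n.primeFactors, p = l),
      l ∣ n ∧ n / l ∈ Nat.factoredNumbers l.primeFactors := by
    intro n hn
    simp only [mem_filter, mem_Icc] at hn
    have hd : l ∣ n := hn.2 ▸ Nat.prod_primeFactors_dvd n
    have hn0 : n ≠ 0 := by omega
    have hpf : l.primeFactors = n.primeFactors := by
      rw [← hn.2]
      exact Nat.primeFactors_prod (fun p hp => Nat.prime_of_mem_primeFactors hp)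
    refine ⟨hd, Nat.mem_factoredNumbers_of_primeFactors_subset ?_ ?_⟩
    · exact (Nat.div_pos (Nat.le_of_dvd (by omega) hd) (Nat.pos_of_ne_zero hl0)).ne'
    · rw [hpf]
      exact Nat.primeFactors_mono (Nat.div_dvd_of_dvd hd) hn0
  set S := (Icc 1 R).filter (fun n => ∏ p ∈ n.primeFactors, p = l) with hS
  have hl0' : (l : ℝ) ≠ 0 := by exact_mod_cast hl0
  have hsum : ∑ n ∈ S, (1 : ℝ) / n = (1 / l) * ∑ n ∈ S, f (n / l) := by
    rw [mul_sum]
    refine sum_congr rfl fun n hn => ?_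
    obtain ⟨hd, -⟩ := hsub n hn
    rw [hf, Nat.cast_div hd hl0']
    field_simp
  have hle : ∑ n ∈ S, f (n / l) ≤ (l : ℝ) / Nat.totient l := by
    let g : S → Nat.factoredNumbers l.primeFactors := fun n => ⟨n.1 / l, (hsub n.1 n.2).2⟩
    have hg : Function.Injective g := by
      intro a b hab
      have := congrArg Subtype.val hab
      simp only [g] at this
      ext
      rw [← Nat.div_mul_cancel (hsub a.1 a.2).1, this, Nat.div_mul_cancel (hsub b.1 b.2).1]
    have h0 : ∀ m : Nat.factoredNumbers l.primeFactors, 0 ≤ f m := by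
      intro m; rw [hf]; positivity
    have := sum_le_hasSum (univ.image g) (fun m _ => h0 m) hs
    rw [sum_image (fun a _ b _ h => hg h)] at this
    rw [← sum_coe_sort S]
    exact this
  rw [hsum]
  calc (1 / (l : ℝ)) * ∑ n ∈ S, f (n / l) ≤ (1 / l) * ((l : ℝ) / Nat.totient l) := by gcongr
    _ = _ := by field_simp

/-- Group the n by their radical. This is what makes the sieve denominator at least log R. -/
theorem sum_inv_le_selbergDenom (R : ℕ) : ∑ n ∈ Icc 1 R, (1 : ℝ) / n ≤ selbergDenom R := by
  have hmaps : ∀ n ∈ Icc 1 R, (∏ p ∈ n.primeFactors, p) ∈ Icc 1 R := by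
    intro n hn
    rw [mem_Icc] at hn ⊢
    have h1 := Nat.le_of_dvd (by omega) (Nat.prod_primeFactors_dvd n)
    refine ⟨Nat.pos_of_ne_zero ?_, by omega⟩
    exact prod_ne_zero_iff.2 fun p hp => (Nat.prime_of_mem_primeFactors hp).ne_zero
  rw [← sum_fiberwise_of_maps_to hmaps, selbergDenom]
  refine sum_le_sum fun l hl => ?_
  by_cases h : Squarefree l
  · have h2 : (μ l : ℝ) ^ 2 = 1 := by
      rcases (moebius_ne_zero_iff_eq_or.1 (moebius_ne_zero_iff_squarefree.2 h)) with h | h <;>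
        simp [h]
    rw [h2]
    exact sum_inv_le_of_primeFactors_prod_eq l R h
  · rw [sum_eq_zero]
    · positivity
    · intro n hn
      exfalso
      apply h
      rw [← (mem_filter.1 hn).2]
      exact Finset.squarefree_prod_of_pairwise_isCoprime
        (fun p hp q hq hpq => Nat.coprime_iff_isRelPrime.1 ((Nat.coprime_primes
          (Nat.prime_of_mem_primeFactors hp) (Nat.prime_of_mem_primeFactors hq)).2 hpq))
        (fun p hp => (Nat.prime_of_mem_primeFactors hp).prime.squarefree)

theorem selbergDenom_pos {R : ℕ} (hR : 1 ≤ R) : 0 < selbergDenom R :=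
  lt_of_lt_of_le (sum_pos (fun n hn => by
    have : 1 ≤ n := (mem_Icc.1 hn).1
    positivity) ⟨1, by simp [hR]⟩) (sum_inv_le_selbergDenom R)

theorem selbergWeight_one {R : ℕ} (hR : 1 ≤ R) : selbergWeight R 1 = 1 := by
  have h := (selbergDenom_pos hR).ne'
  simp only [selbergWeight, one_dvd, filter_true, Nat.div_one, Nat.cast_one, one_mul]
  have : ∀ l ∈ Icc 1 R, (μ l : ℝ) * ((μ l : ℝ) / (Nat.totient l * selbergDenom R)) =
      (μ l : ℝ) ^ 2 / (Nat.totient l : ℝ) / selbergDenom R := by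
    intro l _
    rw [div_div]; ring
  rw [sum_congr rfl this, ← sum_div]
  exact div_self h

/-- For squarefree l = dm one has d/φ(l) = Σ_{k ∣ d} 1/φ(km), and the numbers km are distinct
squarefree integers up to R, so the left side is a partial sum of the right side. -/
theorem mul_sum_moebius_sq_div_totient_le (R d : ℕ) :
    d * ∑ l ∈ Icc 1 R with d ∣ l, (μ l : ℝ) ^ 2 / (Nat.totient l : ℝ) ≤ selbergDenom R := by
  have hden : ∀ m, ∑ l ∈ Icc 1 m, (μ l : ℝ) ^ 2 / (Nat.totient l : ℝ) =
      ∑ l ∈ Icc 1 m with Squarefree l, 1 / (Nat.totient l : ℝ) := by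
    intro m
    rw [sum_filter]
    refine sum_congr rfl fun l _ => ?_
    split_ifs with h
    · rcases (moebius_ne_zero_iff_eq_or.1 (moebius_ne_zero_iff_squarefree.2 h)) with h | h <;>
        simp [h]
    · simp [moebius_eq_zero_of_not_squarefree h]
  have hL : ∑ l ∈ Icc 1 R with d ∣ l, (μ l : ℝ) ^ 2 / (Nat.totient l : ℝ) =
      ∑ l ∈ (Icc 1 R).filter (fun l => Squarefree l ∧ d ∣ l), 1 / (Nat.totient l : ℝ) := by
    rw [sum_filter, sum_filter]
    refine sum_congr rfl fun l _ => ?_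
    by_cases h : Squarefree l
    · rcases (moebius_ne_zero_iff_eq_or.1 (moebius_ne_zero_iff_squarefree.2 h)) with h' | h' <;>
        simp [h', h]
    · simp [moebius_eq_zero_of_not_squarefree h, h]
  rw [hL, selbergDenom, hden]
  set A := (Icc 1 R).filter (fun l => Squarefree l ∧ d ∣ l) with hA
  have key : ∀ l ∈ A, (d : ℝ) * (1 / Nat.totient l) =
      ∑ k ∈ d.divisors, 1 / (Nat.totient (k * (l / d)) : ℝ) := by
    intro l hl
    obtain ⟨hl1, hsq, hd⟩ := by simpa only [hA, mem_filter] using hl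
    obtain ⟨m, rfl⟩ := hd
    have hd0 : 0 < d := Nat.pos_of_ne_zero (left_ne_zero_of_mul hsq.ne_zero)
    have hm0 : 0 < m := Nat.pos_of_ne_zero (right_ne_zero_of_mul hsq.ne_zero)
    have hcop : Nat.Coprime d m := Nat.coprime_of_squarefree_mul hsq
    rw [Nat.mul_div_cancel_left _ hd0]
    have hphi : ∀ n : ℕ, 0 < n → (Nat.totient n : ℝ) ≠ 0 := fun n hn => by
      exact_mod_cast (Nat.totient_pos.2 hn).ne'
    have h1 : ∀ k ∈ d.divisors, 1 / (Nat.totient (k * m) : ℝ) =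
        (Nat.totient (d / k) : ℝ) / (Nat.totient d * Nat.totient m) := by
      intro k hk
      have hkd := Nat.dvd_of_mem_divisors hk
      obtain ⟨j, rfl⟩ := hkd
      have hk0 : 0 < k := Nat.pos_of_mul_pos_right hd0
      have hj0 : 0 < j := Nat.pos_of_mul_pos_left hd0
      have hkj : Nat.Coprime k j :=
        Nat.coprime_of_squarefree_mul (hsq.squarefree_of_dvd (Dvd.intro _ rfl))
      have hkm : Nat.Coprime k m := hcop.coprime_mul_right
      rw [Nat.mul_div_cancel_left _ hk0, Nat.totient_mul hkj, Nat.totient_mul hkm]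
      have := hphi k hk0; have := hphi j hj0; have := hphi m hm0
      push_cast
      field_simp
    rw [sum_congr rfl h1, ← sum_div, Nat.sum_div_divisors d (fun k => (Nat.totient k : ℝ)),
      ← Nat.cast_sum, Nat.sum_totient, Nat.totient_mul hcop]
    push_cast
    ring
  rw [mul_sum, sum_congr rfl key, ← sum_product']
  let g : ℕ × ℕ → ℕ := fun q => q.2 * (q.1 / d)
  have hmem : ∀ q ∈ A ×ˢ d.divisors, 1 ≤ q.1 ∧ q.1 ≤ R ∧ Squarefree q.1 ∧ d ∣ q.1 ∧ q.2 ∣ d := by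
    intro q hq
    simp only [mem_product, hA, mem_filter, mem_Icc, Nat.mem_divisors] at hq
    tauto
  have hdvd : ∀ q ∈ A ×ˢ d.divisors, g q ∣ q.1 := by
    intro q hq
    obtain ⟨-, -, -, h4, h5⟩ := hmem q hq
    calc g q ∣ d * (q.1 / d) := Nat.mul_dvd_mul_right h5 _
      _ = q.1 := Nat.mul_div_cancel' h4
  -- Since m = l/d is coprime to d, the gcd of km with d recovers k, and then m and l; hence
  -- injectivity.
  have hgcd : ∀ q ∈ A ×ˢ d.divisors, Nat.gcd (g q) d = q.2 := by
    rintro ⟨l, k⟩ hq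
    obtain ⟨h1, -, h3, h4, h5⟩ := hmem _ hq
    obtain ⟨m, rfl⟩ := h4
    have hd0 : 0 < d := Nat.pos_of_ne_zero (left_ne_zero_of_mul h3.ne_zero)
    have hcop : Nat.Coprime d m := Nat.coprime_of_squarefree_mul h3
    simp only [g]
    rw [Nat.mul_div_cancel_left _ hd0, Nat.Coprime.gcd_mul_right_cancel _ hcop.symm]
    exact Nat.gcd_eq_left h5
  have hinj : Set.InjOn g (A ×ˢ d.divisors : Finset (ℕ × ℕ)) := by
    rintro ⟨l, k⟩ hq ⟨l', k'⟩ hq' heq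
    have hk : k = k' := by
      have h1 := hgcd _ hq
      have h2 := hgcd _ hq'
      rw [heq] at h1
      exact h1.symm.trans h2
    subst hk
    obtain ⟨h1, -, h3, h4, h5⟩ := hmem _ hq
    obtain ⟨-, -, -, h4', -⟩ := hmem _ hq'
    have hk0 : 0 < k := Nat.pos_of_dvd_of_pos h5
      (Nat.pos_of_dvd_of_pos h4 h1)
    have := Nat.eq_of_mul_eq_mul_left hk0 heq
    simp only [Prod.mk.injEq, and_true]
    dsimp only at h4 h4' this
    rw [← Nat.mul_div_cancel' h4, this, Nat.mul_div_cancel' h4']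
  have himg : ∑ q ∈ A ×ˢ d.divisors, 1 / (Nat.totient (q.2 * (q.1 / d)) : ℝ) =
      ∑ j ∈ (A ×ˢ d.divisors).image g, 1 / (Nat.totient j : ℝ) :=
    (sum_image (f := fun j => 1 / (Nat.totient j : ℝ)) hinj).symm
  rw [himg]
  refine sum_le_sum_of_subset_of_nonneg ?_ (fun _ _ _ => by positivity)
  intro j hj
  obtain ⟨q, hq, rfl⟩ := mem_image.1 hj
  obtain ⟨h1, h2, h3, -, -⟩ := hmem q hq
  have hd' := hdvd q hq
  rw [mem_filter, mem_Icc]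
  exact ⟨⟨Nat.pos_of_dvd_of_pos hd' h1, (Nat.le_of_dvd h1 hd').trans h2⟩, h3.squarefree_of_dvd hd'⟩

theorem abs_selbergWeight_le_one {R : ℕ} (hR : 1 ≤ R) (d : ℕ) : |selbergWeight R d| ≤ 1 := by
  have hpos := selbergDenom_pos hR
  rw [selbergWeight, abs_mul, Nat.abs_cast]
  calc (d : ℝ) * |∑ l ∈ Icc 1 R with d ∣ l,
        (μ (l / d) : ℝ) * ((μ l : ℝ) / (Nat.totient l * selbergDenom R))|
      ≤ d * ∑ l ∈ Icc 1 R with d ∣ l, (μ l : ℝ) ^ 2 / (Nat.totient l : ℝ) / selbergDenom R := by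
        gcongr
        refine (abs_sum_le_sum_abs _ _).trans (sum_le_sum fun l _ => ?_)
        rw [abs_mul, abs_div, abs_of_nonneg (by positivity : 0 ≤ (Nat.totient l * selbergDenom R)),
          div_div]
        have h1 : |(μ (l / d) : ℝ)| ≤ 1 := by exact_mod_cast abs_moebius_le_one
        have h2 : |(μ l : ℝ)| = (μ l : ℝ) ^ 2 := by
          rcases moebius_eq_or l with h | h | h <;> simp [h]
        rw [h2]
        exact mul_le_of_le_one_left (by positivity) h1
    _ = d * (∑ l ∈ Icc 1 R with d ∣ l, (μ l : ℝ) ^ 2 / (Nat.totient l : ℝ)) / selbergDenom R := by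
        rw [← sum_div, mul_div_assoc]
    _ ≤ 1 := by
        rw [div_le_one hpos]
        exact mul_sum_moebius_sq_div_totient_le R d

/-- Writing d = le turns the sum into Σ μ over the divisors of m/l. It is the orthogonality behind
Möbius inversion over multiples. -/
theorem sum_moebius_div_between {l m : ℕ} (hl : l ∣ m) (hm : m ≠ 0) :
    ∑ d ∈ m.divisors with l ∣ d, μ (m / d) = if m = l then 1 else 0 := by
  obtain ⟨k, rfl⟩ := hl
  have hl0 : 0 < l := Nat.pos_of_ne_zero (left_ne_zero_of_mul hm)
  have hk0 : k ≠ 0 := right_ne_zero_of_mul hm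
  have h1 : (l * k).divisors.filter (l ∣ ·) = k.divisors.image (l * ·) := by
    ext d
    simp only [mem_filter, Nat.mem_divisors, mem_image]
    constructor
    · rintro ⟨⟨h1, h2⟩, e, rfl⟩
      exact ⟨e, ⟨Nat.dvd_of_mul_dvd_mul_left hl0 h1, hk0⟩, rfl⟩
    · rintro ⟨e, ⟨h1, h2⟩, rfl⟩
      exact ⟨⟨Nat.mul_dvd_mul_left l h1, hm⟩, Dvd.intro _ rfl⟩
  rw [h1, sum_image (fun a _ b _ h => Nat.eq_of_mul_eq_mul_left hl0 h)]
  have h2 : ∀ e ∈ k.divisors, μ (l * k / (l * e)) = μ (k / e) := by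
    intro e _
    rw [Nat.mul_div_mul_left _ _ hl0]
  rw [sum_congr rfl h2, Nat.sum_div_divisors k (fun e => μ e)]
  have h3 : ∑ e ∈ k.divisors, μ e = (μ * (ζ : ArithmeticFunction ℤ)) k := by
    rw [coe_mul_zeta_apply]
  rw [h3, moebius_mul_coe_zeta, one_apply]
  congr 1
  simp only [eq_iff_iff]
  constructor
  · rintro rfl; simp
  · intro h
    exact Nat.eq_of_mul_eq_mul_left hl0 (by simpa using h)

/-- Dual Möbius inversion of the definition of the weights: it recovers the coordinates in which the
quadratic form is diagonal. -/
theorem sum_selbergWeight_div (R l : ℕ) (hl : l ∈ Icc 1 R) :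
    ∑ d ∈ Icc 1 R with l ∣ d, selbergWeight R d / d =
      (μ l : ℝ) / (Nat.totient l * selbergDenom R) := by
  set y : ℕ → ℝ := fun l => (μ l : ℝ) / (Nat.totient l * selbergDenom R) with hy
  have h1 : ∀ d ∈ (Icc 1 R).filter (l ∣ ·), selbergWeight R d / d =
      ∑ m ∈ Icc 1 R, if d ∣ m then (μ (m / d) : ℝ) * y m else 0 := by
    intro d hd
    have hd1 : 1 ≤ d := (mem_Icc.1 (mem_filter.1 hd).1).1
    have : (d : ℝ) ≠ 0 := by positivity
    rw [selbergWeight, mul_div_cancel_left₀ _ this, sum_filter]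
  rw [sum_congr rfl h1, sum_comm]
  have h2 : ∀ m ∈ Icc 1 R,
      (∑ d ∈ Icc 1 R with l ∣ d, if d ∣ m then (μ (m / d) : ℝ) * y m else 0) =
        if m = l then y m else 0 := by
    intro m hm
    rw [mem_Icc] at hm
    rw [← sum_filter, filter_filter]
    have h3 : (Icc 1 R).filter (fun d => l ∣ d ∧ d ∣ m) = m.divisors.filter (l ∣ ·) := by
      ext d
      simp only [mem_filter, mem_Icc, Nat.mem_divisors]
      constructor
      · rintro ⟨_, h, h'⟩; exact ⟨⟨h', by omega⟩, h⟩
      · rintro ⟨⟨h', _⟩, h⟩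
        exact ⟨⟨Nat.pos_of_dvd_of_pos h' hm.1, (Nat.le_of_dvd hm.1 h').trans hm.2⟩, h, h'⟩
    rw [h3, ← sum_mul]
    by_cases hlm : l ∣ m
    · have := sum_moebius_div_between hlm (by omega)
      have h4 := congrArg (fun z : ℤ => (z : ℝ)) this
      push_cast at h4
      rw [h4]
      split_ifs <;> simp
    · rw [filter_false_of_mem]
      · have : m ≠ l := by rintro rfl; exact hlm dvd_rfl
        simp [this]
      · intro d hd h
        exact hlm (h.trans (Nat.dvd_of_mem_divisors hd))
  rw [sum_congr rfl h2, sum_ite_eq' (Icc 1 R) l y, if_pos hl]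

/-- From 1/[d,e] = (d,e)/(de) and (d,e) = Σ_{l ∣ d, l ∣ e} φ(l), the form becomes Σ_l φ(l) y_l² with
y_l = μ(l)/(φ(l)D), D being the denominator. -/
theorem sum_selbergWeight_mul_div_lcm {R : ℕ} (hR : 1 ≤ R) :
    ∑ d ∈ Icc 1 R, ∑ e ∈ Icc 1 R,
      selbergWeight R d * selbergWeight R e / (Nat.lcm d e : ℝ) = 1 / selbergDenom R := by
  set w := selbergWeight R
  have h1 : ∀ d ∈ Icc 1 R, ∀ e ∈ Icc 1 R, w d * w e / (Nat.lcm d e : ℝ) =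
      ∑ l ∈ Icc 1 R, (Nat.totient l : ℝ) *
        ((if l ∣ d then w d / d else 0) * (if l ∣ e then w e / e else 0)) := by
    intro d hd e he
    rw [mem_Icc] at hd he
    have hd0 : (d : ℝ) ≠ 0 := by have := hd.1; positivity
    have he0 : (e : ℝ) ≠ 0 := by have := he.1; positivity
    have hg : (Nat.gcd d e : ℝ) = ∑ l ∈ Icc 1 R,
        if l ∣ d ∧ l ∣ e then (Nat.totient l : ℝ) else 0 := by
      rw [← sum_filter]
      have : (Icc 1 R).filter (fun l => l ∣ d ∧ l ∣ e) = (Nat.gcd d e).divisors := by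
        ext l
        simp only [mem_filter, mem_Icc, Nat.mem_divisors, Nat.dvd_gcd_iff]
        have : Nat.gcd d e ≠ 0 := (Nat.gcd_pos_of_pos_left e hd.1).ne'
        constructor
        · rintro ⟨_, h⟩; exact ⟨h, this⟩
        · rintro ⟨h, _⟩
          exact ⟨⟨Nat.pos_of_dvd_of_pos h.1 hd.1, (Nat.le_of_dvd hd.1 h.1).trans hd.2⟩, h⟩
      rw [this, ← Nat.cast_sum, Nat.sum_totient]
    have hlcm : (Nat.gcd d e : ℝ) * (Nat.lcm d e : ℝ) = d * e := by
      exact_mod_cast Nat.gcd_mul_lcm d e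
    have hl0 : (Nat.lcm d e : ℝ) ≠ 0 := by
      intro h; rw [h, mul_zero] at hlcm; exact (mul_ne_zero hd0 he0) hlcm.symm
    have : w d * w e / (Nat.lcm d e : ℝ) = (Nat.gcd d e : ℝ) * (w d / d * (w e / e)) := by
      field_simp
      linear_combination (-(w d * w e)) * hlcm
    rw [this, hg, sum_mul]
    refine sum_congr rfl fun l _ => ?_
    by_cases h : l ∣ d <;> by_cases h' : l ∣ e <;> simp [h, h']
  rw [sum_congr rfl fun d hd => sum_congr rfl (h1 d hd)]
  have h2 : ∀ l ∈ Icc 1 R, ∑ d ∈ Icc 1 R, ∑ e ∈ Icc 1 R, (Nat.totient l : ℝ) *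
        ((if l ∣ d then w d / d else 0) * (if l ∣ e then w e / e else 0)) =
      (μ l : ℝ) ^ 2 / (Nat.totient l : ℝ) / selbergDenom R ^ 2 := by
    intro l hl
    simp_rw [← mul_sum, ← sum_mul, ← sum_filter]
    rw [sum_selbergWeight_div R l hl]
    have hphi : (Nat.totient l : ℝ) ≠ 0 := by
      exact_mod_cast (Nat.totient_pos.2 (mem_Icc.1 hl).1).ne'
    have := (selbergDenom_pos hR).ne'
    field_simp
  have h3 : ∑ d ∈ Icc 1 R, ∑ e ∈ Icc 1 R, ∑ l ∈ Icc 1 R, (Nat.totient l : ℝ) *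
        ((if l ∣ d then w d / d else 0) * (if l ∣ e then w e / e else 0)) =
      ∑ l ∈ Icc 1 R, ∑ d ∈ Icc 1 R, ∑ e ∈ Icc 1 R, (Nat.totient l : ℝ) *
        ((if l ∣ d then w d / d else 0) * (if l ∣ e then w e / e else 0)) := by
    rw [sum_congr rfl fun d _ => sum_comm, sum_comm]
  rw [h3, sum_congr rfl h2, ← sum_div]
  have := (selbergDenom_pos hR).ne'
  change selbergDenom R / selbergDenom R ^ 2 = _
  field_simp

end SelbergWeights

/-! ### Exponential sums: Kusmin–Landau, the second difference test, and the phase c/n. -/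

section ExponentialSums

open Finset Real

/-- The additive character `t ↦ exp(2πit)`. -/
noncomputable def expTwoPi (t : ℝ) : ℂ := Complex.exp ((2 * π * t : ℝ) * Complex.I)

theorem norm_expTwoPi (t : ℝ) : ‖expTwoPi t‖ = 1 := Complex.norm_exp_ofReal_mul_I _

theorem expTwoPi_add (s t : ℝ) : expTwoPi (s + t) = expTwoPi s * expTwoPi t := by
  rw [expTwoPi, expTwoPi, expTwoPi, ← Complex.exp_add]
  congr 1; push_cast; ring

theorem expTwoPi_int (j : ℤ) : expTwoPi j = 1 := by
  rw [expTwoPi, Complex.exp_eq_one_iff]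
  exact ⟨j, by push_cast; ring⟩

theorem expTwoPi_re (t : ℝ) : (expTwoPi t).re = cos (2 * π * t) := Complex.exp_ofReal_mul_I_re _

theorem norm_sum_expTwoPi_le_card (s : Finset ℕ) (a : ℕ → ℝ) :
    ‖∑ n ∈ s, expTwoPi (a n)‖ ≤ s.card := by
  refine (norm_sum_le _ _).trans ?_
  simp [norm_expTwoPi]

/-- Abel summation: two boundary terms of size at most B, plus the total variation of the monotone
c, at most 2B. -/
theorem norm_sum_mul_sub_succ_le {c : ℕ → ℝ} {E : ℕ → ℂ} {B : ℝ} {u v : ℕ}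
    (hE : ∀ n, ‖E n‖ ≤ 1) (hc : ∀ n ∈ Ico u v, |c n| ≤ B)
    (hmono : ∀ n, u ≤ n → n + 1 < v → c n ≤ c (n + 1)) (hB : 0 ≤ B) :
    ‖∑ n ∈ Ico u v, (c n : ℂ) * (E n - E (n + 1))‖ ≤ 4 * B := by
  rcases Nat.lt_or_ge u v with huv | huv
  swap
  · rw [Ico_eq_empty_of_le huv]; simpa using hB
  obtain ⟨k, rfl⟩ := Nat.exists_eq_add_of_lt huv
  have habel : ∀ k : ℕ, ∑ n ∈ Ico u (u + k + 1), (c n : ℂ) * (E n - E (n + 1)) =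
      c u * E u - c (u + k) * E (u + k + 1) +
        ∑ n ∈ Ico u (u + k), ((c (n + 1) - c n : ℝ) : ℂ) * E (n + 1) := by
    intro k
    induction k with
    | zero => simp; ring
    | succ k ih =>
      rw [sum_Ico_succ_top (by omega), ← add_assoc u k 1, ih, sum_Ico_succ_top (by omega)]
      push_cast; ring
  have htel : ∀ k : ℕ, ∑ n ∈ Ico u (u + k), (c (n + 1) - c n) = c (u + k) - c u := by
    intro k
    induction k with
    | zero => simp
    | succ k ih => rw [← add_assoc, sum_Ico_succ_top (by omega), ih]; ring
  rw [habel]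
  have h1 : |c u| ≤ B := hc u (by simp)
  have h2 : |c (u + k)| ≤ B := hc _ (by simp)
  have h3 : ‖∑ n ∈ Ico u (u + k), ((c (n + 1) - c n : ℝ) : ℂ) * E (n + 1)‖ ≤
      c (u + k) - c u := by
    rw [← htel]
    refine (norm_sum_le _ _).trans (sum_le_sum fun n hn => ?_)
    rw [mem_Ico] at hn
    have := hmono n hn.1 (by omega)
    rw [norm_mul, Complex.norm_real, Real.norm_of_nonneg (by linarith)]
    exact mul_le_of_le_one_right (by linarith) (hE _)
  have h4 : ‖(c u : ℂ) * E u‖ ≤ B := by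
    rw [norm_mul, Complex.norm_real]
    exact (mul_le_of_le_one_right (norm_nonneg _) (hE _)).trans h1
  have h5 : ‖(c (u + k) : ℂ) * E (u + k + 1)‖ ≤ B := by
    rw [norm_mul, Complex.norm_real]
    exact (mul_le_of_le_one_right (norm_nonneg _) (hE _)).trans h2
  have h6 := norm_add_le ((c u : ℂ) * E u - c (u + k) * E (u + k + 1))
    (∑ n ∈ Ico u (u + k), ((c (n + 1) - c n : ℝ) : ℂ) * E (n + 1))
  have h7 := norm_sub_le ((c u : ℂ) * E u) (c (u + k) * E (u + k + 1))
  rw [abs_le] at h1 h2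
  linarith

theorem two_mul_le_sin_pi_mul {θ t : ℝ} (hθ : 0 ≤ θ) (h1 : θ ≤ t) (h2 : t ≤ 1 - θ) :
    2 * θ ≤ sin (π * t) := by
  have key : ∀ s : ℝ, θ ≤ s → s ≤ 1 / 2 → 2 * θ ≤ sin (π * s) := by
    intro s hs1 hs2
    have := Real.mul_le_sin (x := π * s) (by have := pi_pos; have : 0 ≤ s := by linarith
                                             positivity) (by nlinarith [pi_pos])
    have h : 2 / π * (π * s) = 2 * s := by field_simp
    linarith
  rcases le_total t (1 / 2) with h | h
  · exact key t h1 h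
  · have := key (1 - t) (by linarith) (by linarith)
    rwa [show π * (1 - t) = π - π * t by ring, sin_pi_sub] at this

/-- This is 1/(1 - e(-t)) = 1/2 - (i/2) cot(πt). It exhibits each term of an exponential sum as a
multiple of a difference of neighbouring terms. -/
theorem expTwoPi_sub_eq {s t : ℝ} (h : sin (π * t) ≠ 0) :
    expTwoPi s = (1 / 2 - (cos (π * t) / sin (π * t) : ℝ) * (Complex.I / 2)) *
      (expTwoPi s - expTwoPi (s - t)) := by
  have h0 : expTwoPi (s - t) = expTwoPi s * expTwoPi (-t) := by rw [← expTwoPi_add]; ring_nf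
  have h1 : expTwoPi (-t) = (1 - 2 * (sin (π * t) : ℂ) ^ 2) -
      2 * (sin (π * t) : ℂ) * (cos (π * t) : ℂ) * Complex.I := by
    rw [expTwoPi, Complex.exp_mul_I, ← Complex.ofReal_cos, ← Complex.ofReal_sin,
      show 2 * π * -t = -(2 * (π * t)) by ring, cos_neg, sin_neg, sin_two_mul, cos_two_mul]
    have := sin_sq_add_cos_sq (π * t)
    rw [← eq_sub_iff_add_eq'] at this
    rw [this]
    push_cast; ring
  rw [h0, h1]
  have hs : (sin (π * t) : ℂ) ≠ 0 := by exact_mod_cast h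
  have hsc : (cos (π * t) : ℂ) ^ 2 = 1 - (sin (π * t) : ℂ) ^ 2 := by
    have := sin_sq_add_cos_sq (π * t)
    rw [← eq_sub_iff_add_eq'] at this
    exact_mod_cast this
  push_cast at hs hsc ⊢
  have hI := Complex.I_sq
  field_simp
  generalize Complex.sin (π * t) = S at *
  generalize Complex.cos (π * t) = C at *
  linear_combination (expTwoPi s * 2 * S * C ^ 2) * hI - (expTwoPi s * 2 * S) * hsc

/-- The Kusmin-Landau inequality. -/
theorem norm_sum_expTwoPi_le_of_sub_mem_Icc {a : ℕ → ℝ} {u v : ℕ} {θ : ℝ} (j : ℤ) (hθ : 0 < θ)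
    (hlow : ∀ n ∈ Ico u v, j + θ ≤ a n - a (n + 1))
    (hhigh : ∀ n ∈ Ico u v, a n - a (n + 1) ≤ j + 1 - θ)
    (hanti : ∀ n, u ≤ n → n + 1 < v → a (n + 1) - a (n + 2) ≤ a n - a (n + 1)) :
    ‖∑ n ∈ Ico u v, expTwoPi (a n)‖ ≤ 2 / θ := by
  rcases Nat.lt_or_ge u v with huv | huv
  swap
  · rw [Ico_eq_empty_of_le huv]; simp; positivity
  have hθ2 : θ ≤ 1 / 2 := by
    have h1 := hlow u (by simp [huv])
    have h2 := hhigh u (by simp [huv])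
    linarith
  -- Subtracting the integer j moves the differences into [θ, 1 - θ] without changing the character.
  set t : ℕ → ℝ := fun n => a n - a (n + 1) - j with ht
  have hsin : ∀ n ∈ Ico u v, 2 * θ ≤ sin (π * t n) := fun n hn =>
    two_mul_le_sin_pi_mul hθ.le (by have := hlow n hn; simp only [ht]; linarith)
      (by have := hhigh n hn; simp only [ht]; linarith)
  set c : ℕ → ℝ := fun n => cos (π * t n) / sin (π * t n) with hc
  have hE : ∀ n, expTwoPi (a n - t n) = expTwoPi (a (n + 1)) := by
    intro n
    rw [show a n - t n = a (n + 1) + (j : ℝ) by simp only [ht]; ring, expTwoPi_add, expTwoPi_int,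
      mul_one]
  have hterm : ∀ n ∈ Ico u v, expTwoPi (a n) =
      1 / 2 * (expTwoPi (a n) - expTwoPi (a (n + 1))) -
        Complex.I / 2 * ((c n : ℂ) * (expTwoPi (a n) - expTwoPi (a (n + 1)))) := by
    intro n hn
    have h := expTwoPi_sub_eq (s := a n) (t := t n) (by have := hsin n hn; linarith)
    rw [hE] at h
    simp only [hc]
    linear_combination h
  rw [sum_congr rfl hterm, sum_sub_distrib, ← mul_sum, ← mul_sum]
  have h1 : ‖∑ n ∈ Ico u v, (c n : ℂ) * (expTwoPi (a n) - expTwoPi (a (n + 1)))‖ ≤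
      4 * (1 / (2 * θ)) := by
    refine norm_sum_mul_sub_succ_le (E := fun n => expTwoPi (a n))
      (fun n => (norm_expTwoPi _).le) ?_ ?_ (by positivity)
    · intro n hn
      have := hsin n hn
      simp only [hc]
      rw [abs_div, abs_of_pos (by linarith : 0 < sin (π * t n))]
      exact div_le_div₀ (by norm_num) (abs_cos_le_one _) (by positivity) this
    · intro n hn1 hn2
      have ha := hanti n hn1 hn2
      have s1 := hsin n (mem_Ico.2 ⟨hn1, by omega⟩)
      have s2 := hsin (n + 1) (mem_Ico.2 ⟨by omega, hn2⟩)
      have l2 := hlow (n + 1) (mem_Ico.2 ⟨by omega, hn2⟩)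
      have r1 := hhigh n (mem_Ico.2 ⟨hn1, by omega⟩)
      simp only [hc]
      rw [div_le_div_iff₀ (by linarith) (by linarith)]
      -- Monotonicity of the cotangent, cleared of denominators, is the sign of the sine of the
      -- difference.
      have hs : 0 ≤ sin (π * t n - π * t (n + 1)) := by
        apply sin_nonneg_of_nonneg_of_le_pi
        · rw [← mul_sub]
          refine mul_nonneg pi_pos.le ?_
          simp only [ht]; linarith
        · rw [← mul_sub]
          refine mul_le_of_le_one_right pi_pos.le ?_
          simp only [ht]; linarith
      rw [sin_sub] at hs
      linarith
  have h2 : ‖∑ n ∈ Ico u v, (expTwoPi (a n) - expTwoPi (a (n + 1)))‖ ≤ 2 := by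
    have h3 := sum_Ico_sub (fun n => expTwoPi (a n)) huv.le
    have h4 : ∑ n ∈ Ico u v, (expTwoPi (a n) - expTwoPi (a (n + 1))) =
        expTwoPi (a u) - expTwoPi (a v) := by
      rw [← neg_inj, ← sum_neg_distrib, neg_sub, ← h3]
      simp
    rw [h4]
    refine (norm_sub_le _ _).trans ?_
    rw [norm_expTwoPi, norm_expTwoPi]; norm_num
  refine (norm_sub_le _ _).trans ?_
  rw [norm_mul, norm_mul]
  have e1 : ‖(1 / 2 : ℂ)‖ = 1 / 2 := by norm_num
  have e2 : ‖(Complex.I / 2 : ℂ)‖ = 1 / 2 := by simp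
  rw [e1, e2]
  have h5 : 4 * (1 / (2 * θ)) = 2 / θ := by field_simp; norm_num
  have h6 : 1 ≤ 1 / θ := by rw [le_div_iff₀ hθ]; linarith
  have h7 : 2 / θ = 1 / θ + 1 / θ := by ring
  linarith

theorem exists_eq_Ico_of_ordConnected (s : Finset ℕ)
    (h : ∀ a ∈ s, ∀ b ∈ s, ∀ n, a ≤ n → n ≤ b → n ∈ s) : ∃ u v, s = Ico u v := by
  rcases s.eq_empty_or_nonempty with rfl | hs
  · exact ⟨0, 0, by simp⟩
  · refine ⟨s.min' hs, s.max' hs + 1, ?_⟩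
    ext n
    rw [mem_Ico]
    constructor
    · intro hn
      exact ⟨s.min'_le n hn, Nat.lt_succ_of_le (s.le_max' n hn)⟩
    · rintro ⟨h1, h2⟩
      exact h _ (s.min'_mem hs) _ (s.max'_mem hs) n h1 (by omega)

theorem card_le_of_forall_sub_le (s : Finset ℕ) {B : ℝ} (hB : 0 ≤ B)
    (h : ∀ a ∈ s, ∀ b ∈ s, a ≤ b → (b : ℝ) - a ≤ B) : (s.card : ℝ) ≤ B + 1 := by
  rcases s.eq_empty_or_nonempty with rfl | hs
  · simp; linarith
  · have h1 : s ⊆ Icc (s.min' hs) (s.max' hs) := fun n hn =>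
      mem_Icc.2 ⟨s.min'_le n hn, s.le_max' n hn⟩
    have h2 := card_le_card h1
    rw [Nat.card_Icc] at h2
    have h3 := s.min'_le _ (s.max'_mem hs)
    have h4 := h _ (s.min'_mem hs) _ (s.max'_mem hs) h3
    have h5 : s.card + s.min' hs ≤ s.max' hs + 1 := by omega
    have h6 : (s.card : ℝ) + s.min' hs ≤ s.max' hs + 1 := by exact_mod_cast h5
    linarith

/-- Second difference test, in terms of a parameter `θ`. -/
theorem norm_sum_expTwoPi_le_of_second_difference {a : ℕ → ℝ} {u v : ℕ} {θ κ Δ : ℝ}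
    (hθ : 0 < θ) (hκ : 0 < κ)
    (hpos : ∀ n ∈ Ico u v, 0 ≤ a n - a (n + 1)) (hle : ∀ n ∈ Ico u v, a n - a (n + 1) ≤ Δ)
    (hdiff : ∀ n ∈ Ico u v, ∀ m ∈ Ico u v, n ≤ m →
      κ * ((m : ℝ) - n) ≤ (a n - a (n + 1)) - (a m - a (m + 1))) :
    ‖∑ n ∈ Ico u v, expTwoPi (a n)‖ ≤ (⌊Δ⌋₊ + 1) * (2 * (θ / κ + 1) + 2 / θ) := by
  set δ : ℕ → ℝ := fun n => a n - a (n + 1) with hδ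
  have hanti : ∀ n ∈ Ico u v, ∀ m ∈ Ico u v, n ≤ m → δ m ≤ δ n := by
    intro n hn m hm hnm
    have h1 := hdiff n hn m hm hnm
    have h2 : (n : ℝ) ≤ m := by exact_mod_cast hnm
    have h3 : 0 ≤ κ * ((m : ℝ) - n) := mul_nonneg hκ.le (by linarith)
    simp only [hδ]; linarith
  have hmaps : ∀ n ∈ Ico u v, ⌊δ n⌋₊ ∈ range (⌊Δ⌋₊ + 1) := by
    intro n hn
    rw [mem_range, Nat.lt_succ_iff]
    exact Nat.floor_le_floor (hle n hn)
  rw [← sum_fiberwise_of_maps_to hmaps]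
  have hblock : ∀ j ∈ range (⌊Δ⌋₊ + 1),
      ‖∑ n ∈ Ico u v with ⌊δ n⌋₊ = j, expTwoPi (a n)‖ ≤ 2 * (θ / κ + 1) + 2 / θ := by
    intro j _
    set F := (Ico u v).filter (fun n => ⌊δ n⌋₊ = j) with hF
    have hFm : ∀ n ∈ F, n ∈ Ico u v ∧ (j : ℝ) ≤ δ n ∧ δ n < j + 1 := by
      intro n hn
      obtain ⟨h1, h2⟩ := mem_filter.1 hn
      exact ⟨h1, (Nat.floor_eq_iff (hpos n h1)).1 h2⟩
    -- The differences decrease by at least κ per step, so a window of length θ catches few indices.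
    -- It is used for the windows next to j and to j + 1, where Kusmin–Landau fails.
    have hcard : ∀ s ⊆ F, ∀ p : ℝ, (∀ n ∈ s, p ≤ δ n ∧ δ n ≤ p + θ) →
        (s.card : ℝ) ≤ θ / κ + 1 := by
      intro s hs p hp
      refine card_le_of_forall_sub_le s (by positivity) fun n hn m hm hnm => ?_
      have h1 := hdiff n (hFm n (hs hn)).1 m (hFm m (hs hm)).1 hnm
      have h2 := hp n hn
      have h3 := hp m hm
      rw [le_div_iff₀ hκ]
      simp only [hδ] at h2 h3
      linarith
    rw [← sum_filter_add_sum_filter_not F (fun n => δ n < j + θ),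
      ← sum_filter_add_sum_filter_not (F.filter fun n => ¬ δ n < j + θ)
        (fun n => j + 1 - θ < δ n)]
    have h1 : ‖∑ n ∈ F with δ n < j + θ, expTwoPi (a n)‖ ≤ θ / κ + 1 := by
      refine (norm_sum_expTwoPi_le_card _ a).trans (hcard _ (filter_subset _ _) j fun n hn => ?_)
      obtain ⟨h1, h2⟩ := mem_filter.1 hn
      exact ⟨(hFm n h1).2.1, h2.le⟩
    have h2 : ‖∑ n ∈ (F.filter fun n => ¬ δ n < j + θ) with j + 1 - θ < δ n,
        expTwoPi (a n)‖ ≤ θ / κ + 1 := by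
      refine (norm_sum_expTwoPi_le_card _ a).trans (hcard _
        ((filter_subset _ _).trans (filter_subset _ _)) (j + 1 - θ) fun n hn => ?_)
      obtain ⟨h1, h2⟩ := mem_filter.1 hn
      refine ⟨h2.le, ?_⟩
      have := (hFm n (mem_filter.1 h1).1).2.2
      linarith
    have h3 : ‖∑ n ∈ (F.filter fun n => ¬ δ n < j + θ) with ¬ (j + 1 - θ < δ n),
        expTwoPi (a n)‖ ≤ 2 / θ := by
      set G := (F.filter fun n => ¬ δ n < j + θ).filter (fun n => ¬ (j + 1 - θ < δ n)) with hG
      have hGm : ∀ n, n ∈ G ↔ n ∈ Ico u v ∧ ⌊δ n⌋₊ = j ∧ j + θ ≤ δ n ∧ δ n ≤ j + 1 - θ := by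
        intro n
        simp only [hG, hF, mem_filter, not_lt]
        tauto
      -- Monotone differences make the remaining indices consecutive, so Kusmin–Landau applies to
      -- them.
      obtain ⟨p, q, hpq⟩ := exists_eq_Ico_of_ordConnected G (by
        intro n hn m hm i hni him
        rw [hGm] at hn hm ⊢
        have hi : i ∈ Ico u v := by
          have h1 := mem_Ico.1 hn.1
          have h2 := mem_Ico.1 hm.1
          exact mem_Ico.2 ⟨by omega, by omega⟩
        have h1 := hanti n hn.1 i hi hni
        have h2 := hanti i hi m hm.1 him
        refine ⟨hi, ?_, by linarith, by linarith⟩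
        rw [Nat.floor_eq_iff (hpos i hi)]
        constructor <;> linarith)
      rw [hpq]
      refine norm_sum_expTwoPi_le_of_sub_mem_Icc (j : ℤ) hθ ?_ ?_ ?_
      · intro n hn
        rw [← hpq, hGm] at hn
        exact_mod_cast hn.2.2.1
      · intro n hn
        rw [← hpq, hGm] at hn
        exact_mod_cast hn.2.2.2
      · intro n hn1 hn2
        have m1 : n ∈ Ico p q := mem_Ico.2 ⟨hn1, by omega⟩
        have m2 : n + 1 ∈ Ico p q := mem_Ico.2 ⟨by omega, hn2⟩
        rw [← hpq, hGm] at m1 m2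
        exact hanti n m1.1 (n + 1) m2.1 (by omega)
    refine (norm_add_le _ _).trans ?_
    have h4 := norm_add_le (∑ n ∈ (F.filter fun n => ¬ δ n < j + θ) with j + 1 - θ < δ n,
        expTwoPi (a n)) (∑ n ∈ (F.filter fun n => ¬ δ n < j + θ) with ¬ (j + 1 - θ < δ n),
        expTwoPi (a n))
    linarith
  refine (norm_sum_le _ _).trans ((sum_le_card_nsmul _ _ _ hblock).trans ?_)
  rw [card_range, nsmul_eq_mul]
  push_cast
  exact le_rfl

/-- Exponential sums along `c / n` over a dyadic block. -/
theorem norm_sum_expTwoPi_div_le {c : ℝ} (hc : 0 < c) {N u v : ℕ} (hN : 1 ≤ N) (hu : N ≤ u)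
    (hv : v ≤ 2 * N) :
    ‖∑ n ∈ Ico u v, expTwoPi (c / n)‖ ≤ 42 * √(c / N) + 8 * (N : ℝ) ^ 2 / c := by
  have hN0 : (0 : ℝ) < N := by exact_mod_cast hN
  have hN1 : (1 : ℝ) ≤ N := by exact_mod_cast hN
  set s := √(c / N) with hs
  have hs0 : 0 < s := sqrt_pos.2 (by positivity)
  have hs2 : s ^ 2 = c / N := sq_sqrt (by positivity)
  have hcs : c = s ^ 2 * N := by rw [hs2]; field_simp
  have hdelta : ∀ n ∈ Ico u v, (c / n : ℝ) - c / ((n + 1 : ℕ) : ℝ) = c / (n * (n + 1)) := by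
    intro n hn
    have : (n : ℝ) ≠ 0 := by
      have := (mem_Ico.1 hn).1
      exact_mod_cast (by omega : n ≠ 0)
    push_cast
    field_simp
    ring
  have hrange : ∀ n ∈ Ico u v, (N : ℝ) ≤ n ∧ (n : ℝ) + 1 ≤ 2 * N := by
    intro n hn
    have h1 := mem_Ico.1 hn
    exact ⟨by exact_mod_cast (by omega : N ≤ n), by exact_mod_cast (by omega : n + 1 ≤ 2 * N)⟩
  have hhi : ∀ n ∈ Ico u v, c / ((n : ℝ) * (n + 1)) ≤ c / (N : ℝ) ^ 2 := by
    intro n hn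
    obtain ⟨h1, h2⟩ := hrange n hn
    gcongr
    nlinarith
  have hlo : ∀ n ∈ Ico u v, c / (4 * (N : ℝ) ^ 2) ≤ c / ((n : ℝ) * (n + 1)) := by
    intro n hn
    obtain ⟨h1, h2⟩ := hrange n hn
    have : 0 < (n : ℝ) := by linarith
    refine div_le_div_of_nonneg_left hc.le (by positivity) ?_
    nlinarith
  have hdiff : ∀ n ∈ Ico u v, ∀ m ∈ Ico u v, n ≤ m →
      c / (8 * (N : ℝ) ^ 3) * ((m : ℝ) - n) ≤
        c / ((n : ℝ) * (n + 1)) - c / ((m : ℝ) * (m + 1)) := by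
    intro n hn m hm hnm
    obtain ⟨h1, h2⟩ := hrange n hn
    obtain ⟨h3, h4⟩ := hrange m hm
    have hn0 : 0 < (n : ℝ) := by linarith
    have hm0 : 0 < (m : ℝ) := by linarith
    have hnm' : (n : ℝ) ≤ m := by exact_mod_cast hnm
    have e : c / ((n : ℝ) * (n + 1)) - c / ((m : ℝ) * (m + 1)) =
        c * ((m + n + 1) / (n * (n + 1) * m * (m + 1))) * (m - n) := by
      field_simp; ring
    rw [e]
    refine mul_le_mul_of_nonneg_right ?_ (by linarith)
    rw [div_eq_mul_inv]
    refine mul_le_mul_of_nonneg_left ?_ hc.le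
    have e2 : ((8 * (N : ℝ) ^ 3))⁻¹ ≤ 1 / ((n : ℝ) * (n + 1) * m) := by
      rw [inv_eq_one_div]
      apply one_div_le_one_div_of_le (by positivity)
      calc (n : ℝ) * (n + 1) * m ≤ (2 * N) * (2 * N) * (2 * N) := by
            gcongr <;> linarith
        _ = 8 * (N : ℝ) ^ 3 := by ring
    refine e2.trans ?_
    rw [div_le_div_iff₀ (by positivity) (by positivity)]
    have : 0 ≤ (n : ℝ) * (n + 1) * m * n := by positivity
    nlinarith
  -- Below 1/2 all differences avoid the integers and Kusmin–Landau alone gives the term 8N²/c.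
  -- Otherwise the bound is trivial if s > N, and the second difference test is used if s ≤ N.
  rcases lt_or_ge (c / (N : ℝ) ^ 2) (1 / 2) with hsmall | hbig
  · have h := norm_sum_expTwoPi_le_of_sub_mem_Icc (a := fun n : ℕ => c / (n : ℝ)) (u := u) (v := v)
      (θ := c / (4 * (N : ℝ) ^ 2)) 0 (by positivity)
      (by intro n hn; rw [hdelta n hn]; simpa using hlo n hn)
      (by
        intro n hn
        rw [hdelta n hn]
        have h1 := hhi n hn
        have h2 : c / (4 * (N : ℝ) ^ 2) ≤ c / (N : ℝ) ^ 2 := by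
          gcongr; nlinarith
        push_cast
        linarith)
      (by
        intro n hn1 hn2
        have m1 : n ∈ Ico u v := mem_Ico.2 ⟨hn1, by omega⟩
        have m2 : n + 1 ∈ Ico u v := mem_Ico.2 ⟨by omega, hn2⟩
        have h1 := hdiff n m1 (n + 1) m2 (by omega)
        rw [← hdelta n m1, ← hdelta (n + 1) m2] at h1
        have h2 : 0 ≤ c / (8 * (N : ℝ) ^ 3) * (((n + 1 : ℕ) : ℝ) - n) := by
          push_cast; ring_nf; positivity
        linarith)
    refine h.trans ?_
    have : 2 / (c / (4 * (N : ℝ) ^ 2)) = 8 * (N : ℝ) ^ 2 / c := by field_simp; norm_num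
    rw [this]
    have := hs0.le
    linarith
  · have hlast : 0 ≤ 8 * (N : ℝ) ^ 2 / c := by positivity
    suffices h : ‖∑ n ∈ Ico u v, expTwoPi (c / n)‖ ≤ 42 * s by linarith
    rcases lt_or_ge (N : ℝ) s with hNs | hsN
    · refine (norm_sum_expTwoPi_le_card _ _).trans ?_
      have : (Ico u v).card ≤ N := by rw [Nat.card_Ico]; omega
      have : ((Ico u v).card : ℝ) ≤ N := by exact_mod_cast this
      linarith
    -- The terms θ/κ and 1/θ balance at θ ≈ √κ = s/(√8 N); 3 replaces √8.
    · have h := norm_sum_expTwoPi_le_of_second_difference (a := fun n : ℕ => c / (n : ℝ)) (u := u)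
        (v := v) (θ := s / (3 * N)) (κ := c / (8 * (N : ℝ) ^ 3)) (Δ := c / (N : ℝ) ^ 2)
        (by positivity) (by positivity)
        (by intro n hn; rw [hdelta n hn]; positivity)
        (by intro n hn; rw [hdelta n hn]; exact hhi n hn)
        (by
          intro n hn m hm hnm
          rw [hdelta n hn, hdelta m hm]
          exact hdiff n hn m hm hnm)
      refine h.trans ?_
      have hfl : (⌊c / (N : ℝ) ^ 2⌋₊ : ℝ) ≤ c / (N : ℝ) ^ 2 := Nat.floor_le (by positivity)
      have e1 : s / (3 * N) / (c / (8 * (N : ℝ) ^ 3)) = 8 / 3 * (N / s) := by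
        rw [hcs]; field_simp
      have e2 : 2 / (s / (3 * N)) = 6 * (N / s) := by field_simp; norm_num
      rw [e1, e2]
      have h1 : 1 ≤ N / s := by rw [le_div_iff₀ hs0]; linarith
      calc ((⌊c / (N : ℝ) ^ 2⌋₊ : ℝ) + 1) * (2 * (8 / 3 * (N / s) + 1) + 6 * (N / s))
          ≤ (3 * (c / (N : ℝ) ^ 2)) * (14 * (N / s)) := by
            apply mul_le_mul (by linarith) (by linarith) (by linarith) (by positivity)
        _ = 42 * s := by rw [hcs]; field_simp; norm_num

end ExponentialSums

/-! ### Sawtooth sums over dyadic blocks. -/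

section Sawtooth

open Finset Real

/-- The sawtooth function `{t} - 1/2`. -/
noncomputable def sawtooth (t : ℝ) : ℝ := Int.fract t - 1 / 2

/-- The function `{t}² - {t}`, twice a primitive of the sawtooth function. -/
noncomputable def sawtoothPrimitive (t : ℝ) : ℝ := Int.fract t ^ 2 - Int.fract t

theorem fract_add_cases (t : ℝ) {η : ℝ} (h0 : 0 < η) (h1 : η < 1) :
    (Int.fract t + η < 1 ∧ Int.fract (t + η) = Int.fract t + η) ∨
      (1 ≤ Int.fract t + η ∧ Int.fract (t + η) = Int.fract t + η - 1) := by
  have h2 := Int.fract_nonneg t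
  have h3 := Int.fract_lt_one t
  have h4 := Int.self_sub_floor t
  rcases lt_or_ge (Int.fract t + η) 1 with h | h
  · refine Or.inl ⟨h, ?_⟩
    rw [Int.fract_eq_iff]
    exact ⟨by linarith, h, ⌊t⌋, by linarith⟩
  · refine Or.inr ⟨h, ?_⟩
    rw [Int.fract_eq_iff]
    exact ⟨by linarith, by linarith, ⌊t⌋ + 1, by push_cast; linarith⟩

/-- The quotient is the mean of the sawtooth over [t, t + η]. The function rises with slope 1 and
only jumps downwards, so the mean exceeds the left-end value by at most η/2; `sawtooth_le` is the
mirror image. -/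
theorem le_sawtooth (t : ℝ) {η : ℝ} (h0 : 0 < η) (h1 : η < 1) :
    (sawtoothPrimitive (t + η) - sawtoothPrimitive t) / (2 * η) - η / 2 ≤ sawtooth t := by
  rw [sub_le_iff_le_add, div_le_iff₀ (by linarith)]
  simp only [sawtooth, sawtoothPrimitive]
  have h3 := Int.fract_lt_one t
  rcases fract_add_cases t h0 h1 with ⟨h, e⟩ | ⟨h, e⟩ <;> rw [e] <;> nlinarith

theorem sawtooth_le (t : ℝ) {η : ℝ} (h0 : 0 < η) (h1 : η < 1) :
    sawtooth t ≤ (sawtoothPrimitive t - sawtoothPrimitive (t - η)) / (2 * η) + η / 2 := by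
  rw [← sub_le_iff_le_add, le_div_iff₀ (by linarith)]
  simp only [sawtooth, sawtoothPrimitive]
  have h2 := Int.fract_lt_one (t - η)
  have h3 := Int.fract_nonneg t
  rcases fract_add_cases (t - η) h0 h1 with ⟨h, e⟩ | ⟨h, e⟩ <;> rw [sub_add_cancel] at e <;>
    rw [e] at h3 ⊢ <;> nlinarith

/-- Fourier series of the second Bernoulli polynomial. Its absolute convergence is the reason for
replacing the sawtooth by its primitive. -/
theorem hasSum_cos_div_sq (t : ℝ) :
    HasSum (fun h : ℕ => 1 / (h : ℝ) ^ 2 * cos (2 * π * (h * t)))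
      (π ^ 2 * (sawtoothPrimitive t + 1 / 6)) := by
  have h := hasSum_one_div_nat_pow_mul_cos one_ne_zero (x := Int.fract t)
    ⟨Int.fract_nonneg t, (Int.fract_lt_one t).le⟩
  convert h using 1
  · ext n
    rw [mul_one]
    congr 1
    have : 2 * π * (n * t) = 2 * π * n * Int.fract t + ((n * ⌊t⌋ : ℤ) : ℝ) * (2 * π) := by
      push_cast
      rw [← Int.self_sub_floor]; ring
    rw [this, cos_add_int_mul_two_pi]
  · rw [mul_one]
    simp only [sawtoothPrimitive]
    simp [Polynomial.bernoulli, sum_range_succ, Polynomial.eval_add, Polynomial.eval_monomial, bernoulli_one,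
      bernoulli_eq_bernoulli'_of_ne_one, Nat.factorial]
    ring

/-- Interpolates between 2π|t| and 2. Any exponent below 1/2 keeps the later series over h
convergent, as h^(-2) · h^(1/2) · h^(12/25) = h^(-51/50). -/
theorem norm_expTwoPi_sub_one_le (t : ℝ) : ‖expTwoPi t - 1‖ ≤ 7 * |t| ^ (12 / 25 : ℝ) := by
  rcases le_total |t| 1 with h | h
  · have h1 : ‖expTwoPi t - 1‖ ≤ 7 * |t| := by
      have := Real.norm_exp_I_mul_ofReal_sub_one_le (x := 2 * π * t)
      rw [mul_comm] at this
      refine this.trans ?_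
      rw [Real.norm_eq_abs, abs_mul, abs_of_pos (by positivity : 0 < 2 * π)]
      have := pi_lt_d2
      gcongr
      linarith
    refine h1.trans ?_
    gcongr
    rcases eq_or_lt_of_le (abs_nonneg t) with h0 | h0
    · rw [← h0]; positivity
    · simpa using rpow_le_rpow_of_exponent_ge h0 h (by norm_num : (12 / 25 : ℝ) ≤ 1)
  · have h1 : ‖expTwoPi t - 1‖ ≤ 2 := by
      refine (norm_sub_le _ _).trans ?_
      rw [norm_expTwoPi, norm_one]; norm_num
    have h2 := one_le_rpow h (by norm_num : (0 : ℝ) ≤ 12 / 25)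
    linarith

/-- The sum `∑ h^(-51/50)`. -/
noncomputable def tailConstant : ℝ := ∑' h : ℕ, (h : ℝ) ^ (-(51 / 50) : ℝ)

theorem tailConstant_nonneg : 0 ≤ tailConstant := tsum_nonneg fun _ => by positivity

/-- Shifting by η multiplies the h-th harmonic by e(hη), so the difference gains the factor e(hη) -
1 against the exponential sum with frequency h. -/
theorem abs_sum_sawtoothPrimitive_sub_le (s : Finset ℕ) (t : ℕ → ℝ) (η A : ℝ)
    (hA : ∀ h : ℕ, 1 ≤ h → ‖∑ n ∈ s, expTwoPi (h * t n)‖ ≤ A * √h) :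
    |∑ n ∈ s, (sawtoothPrimitive (t n + η) - sawtoothPrimitive (t n))| ≤
      7 * tailConstant * A * |η| ^ (12 / 25 : ℝ) := by
  have hs : HasSum (fun h : ℕ => ∑ n ∈ s, (1 / (h : ℝ) ^ 2 * cos (2 * π * (h * (t n + η))) -
      1 / (h : ℝ) ^ 2 * cos (2 * π * (h * t n))))
      (∑ n ∈ s, (π ^ 2 * (sawtoothPrimitive (t n + η) + 1 / 6) -
        π ^ 2 * (sawtoothPrimitive (t n) + 1 / 6))) :=
    hasSum_sum fun n _ => (hasSum_cos_div_sq _).sub (hasSum_cos_div_sq _)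
  have hval : ∑ n ∈ s, (π ^ 2 * (sawtoothPrimitive (t n + η) + 1 / 6) -
        π ^ 2 * (sawtoothPrimitive (t n) + 1 / 6)) =
      π ^ 2 * ∑ n ∈ s, (sawtoothPrimitive (t n + η) - sawtoothPrimitive (t n)) := by
    rw [mul_sum]
    exact sum_congr rfl fun n _ => by ring
  rw [hval] at hs
  have hsummable : Summable fun h : ℕ => (h : ℝ) ^ (-(51 / 50) : ℝ) :=
    Real.summable_nat_rpow.2 (by norm_num)
  have hterm : ∀ h : ℕ, ‖∑ n ∈ s, (1 / (h : ℝ) ^ 2 * cos (2 * π * (h * (t n + η))) -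
      1 / (h : ℝ) ^ 2 * cos (2 * π * (h * t n)))‖ ≤
      7 * A * |η| ^ (12 / 25 : ℝ) * (h : ℝ) ^ (-(51 / 50) : ℝ) := by
    intro h
    rcases Nat.eq_zero_or_pos h with rfl | hh
    · simp
    have hh0 : (0 : ℝ) < h := by exact_mod_cast hh
    have e1 : ∑ n ∈ s, (1 / (h : ℝ) ^ 2 * cos (2 * π * (h * (t n + η))) -
        1 / (h : ℝ) ^ 2 * cos (2 * π * (h * t n))) =
        1 / (h : ℝ) ^ 2 * ((expTwoPi (h * η) - 1) * ∑ n ∈ s, expTwoPi (h * t n)).re := by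
      rw [mul_sum, Complex.re_sum, mul_sum]
      refine sum_congr rfl fun n _ => ?_
      rw [sub_mul, one_mul, ← expTwoPi_add, Complex.sub_re, expTwoPi_re, expTwoPi_re]
      ring_nf
    rw [e1, norm_mul, norm_of_nonneg (by positivity)]
    have h1 := hA h hh
    have h2 := norm_expTwoPi_sub_one_le (h * η)
    rw [abs_mul, abs_of_pos hh0, mul_rpow hh0.le (abs_nonneg _)] at h2
    have h3 : ‖((expTwoPi (h * η) - 1) * ∑ n ∈ s, expTwoPi (h * t n)).re‖ ≤
        (7 * ((h : ℝ) ^ (12 / 25 : ℝ) * |η| ^ (12 / 25 : ℝ))) * (A * √h) := by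
      refine (Complex.abs_re_le_norm _).trans ?_
      rw [norm_mul]
      gcongr
    calc 1 / (h : ℝ) ^ 2 * ‖((expTwoPi (h * η) - 1) * ∑ n ∈ s, expTwoPi (h * t n)).re‖
        ≤ 1 / (h : ℝ) ^ 2 *
          ((7 * ((h : ℝ) ^ (12 / 25 : ℝ) * |η| ^ (12 / 25 : ℝ))) * (A * √h)) := by gcongr
      _ = 7 * A * |η| ^ (12 / 25 : ℝ) *
          ((h : ℝ) ^ (-2 : ℝ) * (h : ℝ) ^ (12 / 25 : ℝ) * (h : ℝ) ^ (1 / 2 : ℝ)) := by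
          rw [sqrt_eq_rpow, rpow_neg hh0.le, rpow_two]; ring
      _ = _ := by
          rw [← rpow_add hh0, ← rpow_add hh0]; norm_num
  have hbound := tsum_of_norm_bounded (hsummable.hasSum.mul_left (7 * A * |η| ^ (12 / 25 : ℝ)))
    hterm
  rw [hs.tsum_eq, norm_mul, norm_of_nonneg (by positivity : 0 ≤ π ^ 2)] at hbound
  have hpi : (1 : ℝ) ≤ π ^ 2 := by have := pi_gt_three; nlinarith
  have h0 := norm_nonneg (∑ n ∈ s, (sawtoothPrimitive (t n + η) - sawtoothPrimitive (t n)))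
  rw [Real.norm_eq_abs] at h0 hbound
  calc _ ≤ π ^ 2 * |∑ n ∈ s, (sawtoothPrimitive (t n + η) - sawtoothPrimitive (t n))| :=
        le_mul_of_one_le_left h0 hpi
    _ ≤ _ := hbound
    _ = _ := by rw [tailConstant]; ring

theorem abs_sum_sawtooth_le (s : Finset ℕ) (t : ℕ → ℝ) {η : ℝ} (A : ℝ) (h0 : 0 < η) (h1 : η < 1)
    (hA : ∀ h : ℕ, 1 ≤ h → ‖∑ n ∈ s, expTwoPi (h * t n)‖ ≤ A * √h) :
    |∑ n ∈ s, sawtooth (t n)| ≤ s.card * η + 7 * tailConstant * A * η ^ (-(13 / 25) : ℝ) := by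
  have e1 := abs_sum_sawtoothPrimitive_sub_le s t η A hA
  have e2 := abs_sum_sawtoothPrimitive_sub_le s t (-η) A hA
  rw [abs_neg] at e2
  rw [abs_of_pos h0] at e1 e2
  have hpow : η ^ (12 / 25 : ℝ) = η ^ (-(13 / 25) : ℝ) * η := by
    rw [← rpow_add_one h0.ne']; norm_num
  rw [hpow] at e1 e2
  set P := η ^ (-(13 / 25) : ℝ)
  have hA0 : 0 ≤ A := by
    have := (norm_nonneg _).trans (hA 1 le_rfl)
    simpa using this
  have hK := tailConstant_nonneg
  have hP : 0 ≤ P := by positivity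
  have hKP : 0 ≤ 7 * tailConstant * A * P := by positivity
  have l1 : ∑ n ∈ s, ((sawtoothPrimitive (t n + η) - sawtoothPrimitive (t n)) / (2 * η) - η / 2) ≤
      ∑ n ∈ s, sawtooth (t n) := sum_le_sum fun n _ => le_sawtooth (t n) h0 h1
  have l2 : ∑ n ∈ s, sawtooth (t n) ≤
      ∑ n ∈ s, ((sawtoothPrimitive (t n) - sawtoothPrimitive (t n - η)) / (2 * η) + η / 2) :=
    sum_le_sum fun n _ => sawtooth_le (t n) h0 h1
  rw [sum_sub_distrib, ← sum_div, sum_const, nsmul_eq_mul] at l1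
  rw [sum_add_distrib, ← sum_div, sum_const, nsmul_eq_mul] at l2
  have e3 : ∑ n ∈ s, (sawtoothPrimitive (t n) - sawtoothPrimitive (t n - η)) =
      -∑ n ∈ s, (sawtoothPrimitive (t n + -η) - sawtoothPrimitive (t n)) := by
    rw [← sum_neg_distrib]
    exact sum_congr rfl fun n _ => by rw [← sub_eq_add_neg]; ring
  rw [e3] at l2
  rw [abs_le] at e1 e2 ⊢
  have c0 : (0 : ℝ) ≤ s.card * η := by positivity
  have m1 : -(7 * tailConstant * A * P) / 2 ≤
      (∑ n ∈ s, (sawtoothPrimitive (t n + η) - sawtoothPrimitive (t n))) / (2 * η) := by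
    rw [div_le_div_iff₀ (by norm_num) (by linarith)]
    linarith [e1.1]
  have m2 : (-∑ n ∈ s, (sawtoothPrimitive (t n + -η) - sawtoothPrimitive (t n))) / (2 * η) ≤
      (7 * tailConstant * A * P) / 2 := by
    rw [div_le_div_iff₀ (by linarith) (by norm_num)]
    linarith [e2.1]
  constructor <;> linarith

theorem abs_sum_sawtooth_div_le {z η : ℝ} (hz : 0 < z) (h0 : 0 < η) (h1 : η < 1) {N v : ℕ}
    (hN : 1 ≤ N) (hv : v ≤ 2 * N) :
    |∑ n ∈ Ico N v, sawtooth (z / n)| ≤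
      N * η + 7 * tailConstant * (42 * √(z / N) + 8 * (N : ℝ) ^ 2 / z) *
        η ^ (-(13 / 25) : ℝ) := by
  have h := abs_sum_sawtooth_le (Ico N v) (fun n => z / n) (42 * √(z / N) + 8 * (N : ℝ) ^ 2 / z)
    h0 h1 (by
      intro h hh
      have hh0 : (1 : ℝ) ≤ h := by exact_mod_cast hh
      have hs : 1 ≤ √(h : ℝ) := by rw [one_le_sqrt]; exact hh0
      have := norm_sum_expTwoPi_div_le (c := h * z) (by positivity) hN le_rfl hv
      simp_rw [mul_div_assoc] at this
      refine this.trans ?_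
      rw [sqrt_mul (by positivity), add_mul]
      have h3 : 8 * ((N : ℝ) ^ 2 / (h * z)) ≤ 8 * (N : ℝ) ^ 2 / z * √(h : ℝ) := by
        calc 8 * ((N : ℝ) ^ 2 / (h * z)) ≤ 8 * ((N : ℝ) ^ 2 / z) := by
              gcongr
              exact le_mul_of_one_le_left hz.le hh0
          _ = 8 * (N : ℝ) ^ 2 / z * 1 := by ring
          _ ≤ _ := by gcongr
      linarith)
  refine h.trans ?_
  gcongr
  rw [Nat.card_Ico]; omega

/-- Sawtooth sums over a dyadic block in the range used for the sieve. -/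
theorem exists_abs_sum_sawtooth_div_le : ∃ C : ℝ, 0 ≤ C ∧ ∀ x z : ℝ, 1 ≤ x →
    x ^ (6 / 7 : ℝ) ≤ z → z ≤ 2 * x → ∀ N v : ℕ, x ^ (14 / 29 : ℝ) ≤ N →
    (N : ℝ) ≤ 3 * x ^ (15 / 29 : ℝ) → v ≤ 2 * N →
    |∑ n ∈ Ico N v, sawtooth (z / n)| ≤ C * x ^ (337 / 1000 : ℝ) := by
  refine ⟨1 + 7 * tailConstant * (42 * (2 * (3 * 2)) + 8 * (2 * 27)), ?_, ?_⟩
  · have := tailConstant_nonneg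
    positivity
  intro x z hx hz1 hz2 N v hN1 hN2 hv
  have hx0 : 0 < x := by linarith
  have hN0 : (0 : ℝ) < N := lt_of_lt_of_le (by positivity) hN1
  have hN : 1 ≤ N := by exact_mod_cast (by exact_mod_cast hN0 : 0 < N)
  have hNone : (1 : ℝ) ≤ N := by exact_mod_cast hN
  have hz : 0 < z := lt_of_lt_of_le (by positivity) hz1
  have hpow : ∀ {p q : ℝ}, p ≤ q → x ^ p ≤ x ^ q := fun h => rpow_le_rpow_of_exponent_le hx h
  -- Chosen so that the smoothing loss Nη is half the target. In the other terms η^(-13/25)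
  -- contributes x to the power -(13/25)(337/1000) = -4381/25000.
  set η := x ^ (337 / 1000 : ℝ) / (2 * N) with hη
  have h0 : 0 < η := by positivity
  have h1 : η < 1 := by
    rw [hη, div_lt_one (by positivity)]
    have : x ^ (337 / 1000 : ℝ) ≤ x ^ (14 / 29 : ℝ) := hpow (by norm_num)
    linarith
  have h := abs_sum_sawtooth_div_le hz h0 h1 hN hv
  have hK := tailConstant_nonneg
  have t1 : N * η ≤ x ^ (337 / 1000 : ℝ) := by
    have : N * η = x ^ (337 / 1000 : ℝ) / 2 := by rw [hη]; field_simp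
    rw [this]
    have : 0 < x ^ (337 / 1000 : ℝ) := by positivity
    linarith
  have hηp : η ^ (-(13 / 25) : ℝ) ≤
      2 * (N : ℝ) ^ (13 / 25 : ℝ) * x ^ (-(4381 / 25000) : ℝ) := by
    rw [hη, div_rpow (by positivity) (by positivity), ← rpow_mul hx0.le,
      rpow_neg (by positivity : (0 : ℝ) ≤ 2 * N), div_inv_eq_mul,
      mul_rpow (by norm_num) hN0.le, mul_comm]
    have : (2 : ℝ) ^ (13 / 25 : ℝ) ≤ 2 := by
      simpa using rpow_le_rpow_of_exponent_le (by norm_num : (1 : ℝ) ≤ 2)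
        (by norm_num : (13 / 25 : ℝ) ≤ 1)
    norm_num only
    gcongr
  have t2 : √(z / N) * η ^ (-(13 / 25) : ℝ) ≤ 2 * (3 * 2) * x ^ (337 / 1000 : ℝ) := by
    have s1 : √(z / N) = √z * (N : ℝ) ^ (-(1 / 2) : ℝ) := by
      rw [sqrt_div hz.le, sqrt_eq_rpow (N : ℝ), rpow_neg hN0.le]; rfl
    have s2 : √z ≤ 2 * x ^ (1 / 2 : ℝ) := by
      rw [← sqrt_eq_rpow, sqrt_le_left (by positivity), mul_pow, sq_sqrt hx0.le]
      linarith
    have s3 : (N : ℝ) ^ (1 / 50 : ℝ) ≤ 3 * x ^ (3 / 290 : ℝ) := by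
      calc (N : ℝ) ^ (1 / 50 : ℝ) ≤ (3 * x ^ (15 / 29 : ℝ)) ^ (1 / 50 : ℝ) := by gcongr
        _ = 3 ^ (1 / 50 : ℝ) * x ^ (3 / 290 : ℝ) := by
            rw [mul_rpow (by norm_num) (by positivity), ← rpow_mul hx0.le]; norm_num
        _ ≤ 3 * x ^ (3 / 290 : ℝ) := by
            gcongr
            simpa using rpow_le_rpow_of_exponent_le (by norm_num : (1 : ℝ) ≤ 3)
              (by norm_num : (1 / 50 : ℝ) ≤ 1)
    calc √(z / N) * η ^ (-(13 / 25) : ℝ)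
        ≤ (2 * x ^ (1 / 2 : ℝ) * (N : ℝ) ^ (-(1 / 2) : ℝ)) *
          (2 * (N : ℝ) ^ (13 / 25 : ℝ) * x ^ (-(4381 / 25000) : ℝ)) := by
          rw [s1]; gcongr
      _ = 2 * 2 * ((N : ℝ) ^ (-(1 / 2) : ℝ) * (N : ℝ) ^ (13 / 25 : ℝ)) *
          (x ^ (1 / 2 : ℝ) * x ^ (-(4381 / 25000) : ℝ)) := by ring
      _ = 2 * 2 * (N : ℝ) ^ (1 / 50 : ℝ) * x ^ (8119 / 25000 : ℝ) := by
          rw [← rpow_add hN0, ← rpow_add hx0]; norm_num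
      _ ≤ 2 * 2 * (3 * x ^ (3 / 290 : ℝ)) * x ^ (8119 / 25000 : ℝ) := by gcongr
      _ = 2 * (3 * 2) * (x ^ (3 / 290 : ℝ) * x ^ (8119 / 25000 : ℝ)) := by ring
      _ ≤ 2 * (3 * 2) * x ^ (337 / 1000 : ℝ) := by
          rw [← rpow_add hx0]
          gcongr 2 * (3 * 2) * ?_
          exact hpow (by norm_num)
  have t3 : (N : ℝ) ^ 2 / z * η ^ (-(13 / 25) : ℝ) ≤ 2 * 27 * x ^ (337 / 1000 : ℝ) := by
    have s3 : (N : ℝ) ^ (63 / 25 : ℝ) ≤ 27 * x ^ (189 / 145 : ℝ) := by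
      calc (N : ℝ) ^ (63 / 25 : ℝ) ≤ (3 * x ^ (15 / 29 : ℝ)) ^ (63 / 25 : ℝ) := by gcongr
        _ = 3 ^ (63 / 25 : ℝ) * x ^ (189 / 145 : ℝ) := by
            rw [mul_rpow (by norm_num) (by positivity), ← rpow_mul hx0.le]; norm_num
        _ ≤ 27 * x ^ (189 / 145 : ℝ) := by
            gcongr
            calc (3 : ℝ) ^ (63 / 25 : ℝ) ≤ 3 ^ (3 : ℝ) :=
                  rpow_le_rpow_of_exponent_le (by norm_num) (by norm_num)
              _ = 27 := by norm_num
    calc (N : ℝ) ^ 2 / z * η ^ (-(13 / 25) : ℝ)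
        ≤ (N : ℝ) ^ 2 / x ^ (6 / 7 : ℝ) *
          (2 * (N : ℝ) ^ (13 / 25 : ℝ) * x ^ (-(4381 / 25000) : ℝ)) := by gcongr
      _ = 2 * ((N : ℝ) ^ (2 : ℝ) * (N : ℝ) ^ (13 / 25 : ℝ)) *
          (x ^ (-(6 / 7) : ℝ) * x ^ (-(4381 / 25000) : ℝ)) := by
          rw [rpow_two, rpow_neg hx0.le (6 / 7)]; ring
      _ = 2 * (N : ℝ) ^ (63 / 25 : ℝ) * x ^ (-(180667 / 175000) : ℝ) := by
          rw [← rpow_add hN0, ← rpow_add hx0]; norm_num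
      _ ≤ 2 * (27 * x ^ (189 / 145 : ℝ)) * x ^ (-(180667 / 175000) : ℝ) := by gcongr
      _ = 2 * 27 * (x ^ (189 / 145 : ℝ) * x ^ (-(180667 / 175000) : ℝ)) := by ring
      _ ≤ 2 * 27 * x ^ (337 / 1000 : ℝ) := by
          rw [← rpow_add hx0]
          gcongr 2 * 27 * ?_
          exact hpow (by norm_num)
  calc |∑ n ∈ Ico N v, sawtooth (z / n)| ≤ _ := h
    _ = N * η + 7 * tailConstant * (42 * (√(z / N) * η ^ (-(13 / 25) : ℝ)) +
          8 * ((N : ℝ) ^ 2 / z * η ^ (-(13 / 25) : ℝ))) := by ring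
    _ ≤ x ^ (337 / 1000 : ℝ) + 7 * tailConstant * (42 * (2 * (3 * 2) * x ^ (337 / 1000 : ℝ)) +
          8 * (2 * 27 * x ^ (337 / 1000 : ℝ))) := by gcongr
    _ = _ := by ring

theorem abs_sum_Ico_le_of_dyadic {f : ℕ → ℝ} {B : ℝ} {a b₀ : ℕ} (hB : 0 ≤ B)
    (h : ∀ N v, a ≤ N → N ≤ b₀ → v ≤ 2 * N → |∑ n ∈ Ico N v, f n| ≤ B) (k b : ℕ)
    (hb : b ≤ b₀) (hbk : b ≤ 2 ^ k * a) : |∑ n ∈ Ico a b, f n| ≤ k * B := by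
  induction k generalizing b with
  | zero => rw [Ico_eq_empty_of_le (by simpa using hbk)]; simp
  | succ k ih =>
    rcases le_total b (2 ^ k * a) with h1 | h1
    · refine (ih b hb h1).trans ?_
      push_cast; linarith
    · have ha : a ≤ 2 ^ k * a := Nat.le_mul_of_pos_left a (by positivity)
      rw [← sum_Ico_consecutive f ha h1]
      have h2 := ih (2 ^ k * a) (h1.trans hb) le_rfl
      have h3 := h (2 ^ k * a) b ha (h1.trans hb) (by rw [pow_succ] at hbk; linarith)
      refine (abs_add_le _ _).trans ?_
      push_cast; linarith

end Sawtooth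

/-! ### Selberg's sieve on average over the cofactor n. -/

section Sieve

open Finset Real

theorem card_Ioc_filter_dvd {X Y : ℝ} (hX : 0 ≤ X) (hXY : X ≤ Y) {d : ℕ} :
    (((Ioc ⌊X⌋₊ ⌊Y⌋₊).filter (d ∣ ·)).card : ℝ) =
      (Y - X) / d - sawtooth (Y / d) + sawtooth (X / d) := by
  have h1 : ⌊X⌋₊ ≤ ⌊Y⌋₊ := Nat.floor_le_floor hXY
  have h2 : ((Ioc 0 ⌊X⌋₊).filter (d ∣ ·)).card + ((Ioc ⌊X⌋₊ ⌊Y⌋₊).filter (d ∣ ·)).card =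
      ((Ioc 0 ⌊Y⌋₊).filter (d ∣ ·)).card := by
    rw [← card_union_of_disjoint, ← filter_union, Ioc_union_Ioc_eq_Ioc (Nat.zero_le _) h1]
    exact disjoint_filter_filter (Ioc_disjoint_Ioc_of_le le_rfl)
  rw [Nat.Ioc_filter_dvd_card_eq_div, Nat.Ioc_filter_dvd_card_eq_div, ← Nat.floor_div_natCast,
    ← Nat.floor_div_natCast] at h2
  have h3 : ∀ t : ℝ, 0 ≤ t → (⌊t⌋₊ : ℝ) = t - 1 / 2 - sawtooth t := by
    intro t ht
    rw [natCast_floor_eq_intCast_floor ht, sawtooth, ← Int.self_sub_floor]; ring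
  have h4 : (⌊X / d⌋₊ : ℝ) + ((Ioc ⌊X⌋₊ ⌊Y⌋₊).filter (d ∣ ·)).card = ⌊Y / d⌋₊ := by
    exact_mod_cast h2
  rw [h3 _ (by positivity), h3 _ (div_nonneg (hX.trans hXY) (by positivity))] at h4
  rw [sub_div]
  linarith

/-- A prime k > R has no divisor up to R except 1, whose weight is 1. -/
theorem indicator_prime_le_sq_sum_selbergWeight {R k : ℕ} (hR : 1 ≤ R) (hk : R < k) :
    (if k.Prime then (1 : ℝ) else 0) ≤
      (∑ d ∈ Icc 1 R with d ∣ k, selbergWeight R d) ^ 2 := by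
  split_ifs with h
  · have : (Icc 1 R).filter (· ∣ k) = {1} := by
      ext d
      simp only [mem_filter, mem_Icc, mem_singleton]
      constructor
      · rintro ⟨⟨h1, h2⟩, h3⟩
        rcases (Nat.dvd_prime h).1 h3 with h4 | h4
        · exact h4
        · omega
      · rintro rfl
        simp [hR]
    rw [this, sum_singleton, selbergWeight_one hR]; norm_num
  · positivity

/-- Selberg's sieve applied to cofactors of the integers in a short interval. -/
theorem sum_card_primes_le {x y B : ℝ} {R a b : ℕ} (hx : 0 ≤ x) (hy : 0 ≤ y) (hR : 1 ≤ R)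
    (hRx : ∀ n ∈ Ico a b, (R : ℝ) ≤ x / n)
    (hB : ∀ d ∈ Icc 1 (R ^ 2), |∑ n ∈ Ico a b, sawtooth ((x + y) / d / n)| ≤ B ∧
      |∑ n ∈ Ico a b, sawtooth (x / d / n)| ≤ B) :
    ∑ n ∈ Ico a b, (((Ioc ⌊x / n⌋₊ ⌊(x + y) / n⌋₊).filter Nat.Prime).card : ℝ) ≤
      y * (∑ n ∈ Ico a b, (1 : ℝ) / n) / selbergDenom R + (R : ℝ) ^ 2 * (2 * B) := by
  set w := selbergWeight R
  set H := ∑ n ∈ Ico a b, (1 : ℝ) / n with hH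
  set I : ℕ → Finset ℕ := fun n => Ioc ⌊x / n⌋₊ ⌊(x + y) / n⌋₊ with hI
  have h1 : ∀ n ∈ Ico a b, (((I n).filter Nat.Prime).card : ℝ) ≤
      ∑ d ∈ Icc 1 R, ∑ e ∈ Icc 1 R, w d * w e * ((I n).filter (Nat.lcm d e ∣ ·)).card := by
    intro n hn
    have h2 : (((I n).filter Nat.Prime).card : ℝ) ≤
        ∑ k ∈ I n, (∑ d ∈ Icc 1 R with d ∣ k, w d) ^ 2 := by
      rw [card_filter]
      push_cast
      refine sum_le_sum fun k hk => indicator_prime_le_sq_sum_selbergWeight hR ?_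
      have h3 := (mem_Ioc.1 hk).1
      have h4 := Nat.le_floor (hRx n hn)
      omega
    refine h2.trans (le_of_eq ?_)
    have h3 : ∀ k, (∑ d ∈ Icc 1 R with d ∣ k, w d) ^ 2 =
        ∑ d ∈ Icc 1 R, ∑ e ∈ Icc 1 R, w d * w e * (if Nat.lcm d e ∣ k then 1 else 0) := by
      intro k
      rw [sq, sum_filter, sum_mul_sum]
      refine sum_congr rfl fun d _ => sum_congr rfl fun e _ => ?_
      by_cases h : d ∣ k <;> by_cases h' : e ∣ k <;> simp [Nat.lcm_dvd_iff, h, h']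
    simp_rw [h3]
    rw [sum_comm]
    refine sum_congr rfl fun d _ => ?_
    rw [sum_comm]
    refine sum_congr rfl fun e _ => ?_
    rw [← mul_sum, card_filter]
    push_cast
    rfl
  have hcount : ∀ d : ℕ, ∑ n ∈ Ico a b, (((I n).filter (d ∣ ·)).card : ℝ) =
      y * H / d - ∑ n ∈ Ico a b, sawtooth ((x + y) / d / n) +
        ∑ n ∈ Ico a b, sawtooth (x / d / n) := by
    intro d
    rw [hH, mul_sum, sum_div, ← sum_sub_distrib, ← sum_add_distrib]
    refine sum_congr rfl fun n _ => ?_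
    rw [hI, card_Ioc_filter_dvd (by positivity) (by gcongr; linarith), div_right_comm x,
      div_right_comm (x + y)]
    ring
  have hw : ∀ d, |w d| ≤ 1 := abs_selbergWeight_le_one hR
  -- As the weights are at most 1 in size, each of the R² pairs loses at most two sawtooth sums,
  -- with modulus [d,e] ≤ R².
  have hpair : ∀ d ∈ Icc 1 R, ∀ e ∈ Icc 1 R,
      w d * w e * ∑ n ∈ Ico a b, (((I n).filter (Nat.lcm d e ∣ ·)).card : ℝ) ≤
        y * H * (w d * w e / (Nat.lcm d e : ℝ)) + 2 * B := by
    intro d hd e he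
    rw [mem_Icc] at hd he
    have hl : Nat.lcm d e ∈ Icc 1 (R ^ 2) := by
      rw [mem_Icc]
      refine ⟨Nat.lcm_pos hd.1 he.1, ?_⟩
      calc Nat.lcm d e ≤ d * e := Nat.le_of_dvd (Nat.mul_pos hd.1 he.1) (Nat.lcm_dvd_mul d e)
        _ ≤ R * R := Nat.mul_le_mul hd.2 he.2
        _ = R ^ 2 := (sq R).symm
    obtain ⟨b1, b2⟩ := hB _ hl
    rw [hcount]
    set s1 := ∑ n ∈ Ico a b, sawtooth ((x + y) / (Nat.lcm d e : ℕ) / n)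
    set s2 := ∑ n ∈ Ico a b, sawtooth (x / (Nat.lcm d e : ℕ) / n)
    have hww : |w d * w e| ≤ 1 := by
      rw [abs_mul]
      exact mul_le_one₀ (hw d) (abs_nonneg _) (hw e)
    have h5 : w d * w e * (s2 - s1) ≤ 2 * B := by
      calc w d * w e * (s2 - s1) ≤ |w d * w e * (s2 - s1)| := le_abs_self _
        _ = |w d * w e| * |s2 - s1| := abs_mul _ _
        _ ≤ 1 * |s2 - s1| := by gcongr
        _ ≤ 2 * B := by
          have := abs_sub s2 s1
          linarith
    have h6 : w d * w e * (y * H / (Nat.lcm d e : ℝ) - s1 + s2) =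
        y * H * (w d * w e / (Nat.lcm d e : ℝ)) + w d * w e * (s2 - s1) := by ring
    rw [h6]
    linarith
  calc ∑ n ∈ Ico a b, (((I n).filter Nat.Prime).card : ℝ)
      ≤ ∑ n ∈ Ico a b, ∑ d ∈ Icc 1 R, ∑ e ∈ Icc 1 R,
          w d * w e * ((I n).filter (Nat.lcm d e ∣ ·)).card := sum_le_sum h1
    _ = ∑ d ∈ Icc 1 R, ∑ e ∈ Icc 1 R,
          w d * w e * ∑ n ∈ Ico a b, (((I n).filter (Nat.lcm d e ∣ ·)).card : ℝ) := by
        rw [sum_comm]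
        refine sum_congr rfl fun d _ => ?_
        rw [sum_comm]
        exact sum_congr rfl fun e _ => (mul_sum _ _ _).symm
    _ ≤ ∑ d ∈ Icc 1 R, ∑ e ∈ Icc 1 R,
          (y * H * (w d * w e / (Nat.lcm d e : ℝ)) + 2 * B) :=
        sum_le_sum fun d hd => sum_le_sum fun e he => hpair d hd e he
    _ = y * H * (∑ d ∈ Icc 1 R, ∑ e ∈ Icc 1 R, w d * w e / (Nat.lcm d e : ℝ)) +
          (R : ℝ) ^ 2 * (2 * B) := by
        simp_rw [sum_add_distrib, ← mul_sum, sum_const, Nat.card_Icc, nsmul_eq_mul]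
        push_cast
        simp
        ring
    _ = _ := by
        rw [sum_selbergWeight_mul_div_lcm hR]; ring

/-- The contribution of the primes near the square root of `x`. -/
theorem exists_sum_card_primes_le : ∃ C : ℝ, 0 ≤ C ∧ ∀ x y : ℝ, 1 ≤ x → 0 ≤ y → y ≤ x →
    ∀ a b R k : ℕ, x ^ (14 / 29 : ℝ) ≤ a → (b : ℝ) ≤ 3 * x ^ (15 / 29 : ℝ) → b ≤ 2 ^ k * a →
    1 ≤ R → (R : ℝ) ≤ x ^ (1 / 14 : ℝ) → (∀ n ∈ Ico a b, (R : ℝ) ≤ x / n) →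
    ∑ n ∈ Ico a b, (((Ioc ⌊x / n⌋₊ ⌊(x + y) / n⌋₊).filter Nat.Prime).card : ℝ) ≤
      y * (∑ n ∈ Ico a b, (1 : ℝ) / n) / selbergDenom R +
        (R : ℝ) ^ 2 * (2 * (k * (C * x ^ (337 / 1000 : ℝ)))) := by
  obtain ⟨C, hC, h⟩ := exists_abs_sum_sawtooth_div_le
  refine ⟨C, hC, ?_⟩
  intro x y hx hy hyx a b R k ha hb hk hR hRx hRn
  have hx0 : 0 < x := by linarith
  refine sum_card_primes_le hx0.le hy hR hRn ?_
  intro d hd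
  rw [mem_Icc] at hd
  have hd1 : (1 : ℝ) ≤ d := by exact_mod_cast hd.1
  have hd2 : (d : ℝ) ≤ x ^ (1 / 7 : ℝ) := by
    calc (d : ℝ) ≤ (R : ℝ) ^ 2 := by exact_mod_cast hd.2
      _ ≤ (x ^ (1 / 14 : ℝ)) ^ 2 := by gcongr
      _ = x ^ (1 / 7 : ℝ) := by rw [← rpow_natCast, ← rpow_mul hx0.le]; norm_num
  have key : ∀ t : ℝ, x ≤ t → t ≤ 2 * x →
      |∑ n ∈ Ico a b, sawtooth (t / d / n)| ≤ k * (C * x ^ (337 / 1000 : ℝ)) := by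
    intro t ht1 ht2
    refine abs_sum_Ico_le_of_dyadic (b₀ := b) (by positivity) ?_ k b le_rfl hk
    intro N v hN1 hN2 hv
    refine h x (t / d) hx ?_ ?_ N v ?_ ?_ hv
    · rw [le_div_iff₀ (by linarith)]
      calc x ^ (6 / 7 : ℝ) * d ≤ x ^ (6 / 7 : ℝ) * x ^ (1 / 7 : ℝ) := by gcongr
        _ = x := by rw [← rpow_add hx0]; norm_num
        _ ≤ t := ht1
    · exact (div_le_self (by linarith) hd1).trans ht2
    · exact ha.trans (by exact_mod_cast hN1)
    · exact le_trans (by exact_mod_cast hN2) hb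
  exact ⟨key (x + y) (by linarith) (by linarith), key x le_rfl (by linarith)⟩

end Sieve

/-! ### Chebyshev's argument in a short interval. -/

section ShortIntervals

open Finset Real

theorem card_Ioc_filter_dvd_le {X Y : ℝ} (hX : 0 ≤ X) (hXY : X ≤ Y) (d : ℕ) :
    (((Ioc ⌊X⌋₊ ⌊Y⌋₊).filter (d ∣ ·)).card : ℝ) ≤ (Y - X) / d + 1 := by
  rw [card_Ioc_filter_dvd hX hXY]
  have h1 := Int.fract_nonneg (Y / d)
  have h2 := Int.fract_lt_one (X / d)
  simp only [sawtooth]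
  linarith

/-- Mertens' argument: log Y! = Σ Λ(q)⌊Y/q⌋ ≤ Y log Y, and removing the floors costs ψ(Y), bounded
by Chebyshev. -/
theorem sum_vonMangoldt_div_le {Y : ℕ} (hY : 1 ≤ Y) :
    ∑ q ∈ Ioc 0 Y, ArithmeticFunction.vonMangoldt q / q ≤ log Y + (log 4 + 4) := by
  have hY0 : (0 : ℝ) < Y := by exact_mod_cast hY
  have h1 : ∑ m ∈ Ioc 0 Y, log m =
      ∑ q ∈ Ioc 0 Y, ArithmeticFunction.vonMangoldt q * (Y / q : ℕ) := by
    have h2 : ∀ m ∈ Ioc 0 Y, log m =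
        ∑ q ∈ Ioc 0 Y, if q ∣ m then ArithmeticFunction.vonMangoldt q else 0 := by
      intro m hm
      rw [mem_Ioc] at hm
      rw [← ArithmeticFunction.vonMangoldt_sum, ← sum_filter]
      refine sum_congr ?_ fun _ _ => rfl
      ext q
      simp only [Nat.mem_divisors, mem_filter, mem_Ioc]
      constructor
      · rintro ⟨h, -⟩
        exact ⟨⟨Nat.pos_of_dvd_of_pos h hm.1, (Nat.le_of_dvd hm.1 h).trans hm.2⟩, h⟩
      · rintro ⟨-, h⟩
        exact ⟨h, by omega⟩
    rw [sum_congr rfl h2, sum_comm]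
    refine sum_congr rfl fun q _ => ?_
    rw [← sum_filter, sum_const, Nat.Ioc_filter_dvd_card_eq_div, nsmul_eq_mul, mul_comm]
  have h3 : ∑ m ∈ Ioc 0 Y, log m ≤ Y * log Y := by
    have h4 : ∀ m ∈ Ioc 0 Y, log (m : ℝ) ≤ log Y := by
      intro m hm
      rw [mem_Ioc] at hm
      exact log_le_log (by exact_mod_cast hm.1) (by exact_mod_cast hm.2)
    have := sum_le_card_nsmul _ _ _ h4
    simpa using this
  have h5 : ∑ q ∈ Ioc 0 Y, ArithmeticFunction.vonMangoldt q * ((Y : ℝ) / q - 1) ≤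
      ∑ q ∈ Ioc 0 Y, ArithmeticFunction.vonMangoldt q * (Y / q : ℕ) := by
    refine sum_le_sum fun q _ => ?_
    refine mul_le_mul_of_nonneg_left ?_ ArithmeticFunction.vonMangoldt_nonneg
    rw [← Nat.floor_div_eq_div (K := ℝ)]
    exact (Nat.sub_one_lt_floor _).le
  have h6 : ∑ q ∈ Ioc 0 Y, ArithmeticFunction.vonMangoldt q * ((Y : ℝ) / q - 1) =
      Y * ∑ q ∈ Ioc 0 Y, ArithmeticFunction.vonMangoldt q / q - Chebyshev.psi Y := by
    rw [Chebyshev.psi, Nat.floor_natCast, mul_sum, ← sum_sub_distrib]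
    exact sum_congr rfl fun q _ => by ring
  have h7 := Chebyshev.psi_le_const_mul_self hY0.le
  have h8 : Y * ∑ q ∈ Ioc 0 Y, ArithmeticFunction.vonMangoldt q / q ≤
      Y * (log Y + (log 4 + 4)) := by linarith
  exact le_of_mul_le_mul_left h8 hY0

open Classical in
-- Write m = s²k. Two such m with the same k differ by at least 2sk > 2√x > y, so m ↦ k is
-- injective, and k ≤ (x + y)/S².
theorem card_filter_exists_sq_dvd_of_large_le {x y : ℝ} (hx : 1 ≤ x) (hy : 0 ≤ y) (hyx : y ≤ √x)
    {S : ℕ} (hS : 1 ≤ S) :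
    (((Ioc ⌊x⌋₊ ⌊x + y⌋₊).filter (fun m => ∃ s, S ≤ s ∧ s ^ 2 ∣ m)).card : ℝ) ≤
      (x + y) / (S : ℝ) ^ 2 := by
  set J := Ioc ⌊x⌋₊ ⌊x + y⌋₊
  have hS0 : (0 : ℝ) < (S : ℝ) ^ 2 := by have : (0 : ℝ) < S := by exact_mod_cast hS
                                         positivity
  have hmem : ∀ m ∈ J.filter (fun m => ∃ s, S ≤ s ∧ s ^ 2 ∣ m),
      ∃ s k : ℕ, S ≤ s ∧ m = s ^ 2 * k ∧ 0 < k ∧ x < m ∧ (m : ℝ) ≤ x + y := by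
    intro m hm
    obtain ⟨h1, s, h2, k, hk⟩ := mem_filter.1 hm
    rw [mem_Ioc] at h1
    have h3 : x < m := Nat.lt_of_floor_lt h1.1
    refine ⟨s, k, h2, hk, ?_, h3, (Nat.le_floor_iff (by linarith)).1 h1.2⟩
    rcases Nat.eq_zero_or_pos k with rfl | h
    · rw [mul_zero] at hk
      rw [hk] at h3
      norm_num at h3; linarith
    · exact h
  choose! s k hs using hmem
  have hmaps : ∀ m ∈ J.filter (fun m => ∃ s, S ≤ s ∧ s ^ 2 ∣ m),
      k m ∈ Ioc 0 ⌊(x + y) / (S : ℝ) ^ 2⌋₊ := by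
    intro m hm
    obtain ⟨h1, h2, h3, h4, h5⟩ := hs m hm
    refine mem_Ioc.2 ⟨h3, Nat.le_floor ?_⟩
    rw [le_div_iff₀ hS0]
    have h6 : (S : ℝ) ^ 2 ≤ (s m : ℝ) ^ 2 := by
      have : (S : ℝ) ≤ s m := by exact_mod_cast h1
      gcongr
    have h7 : (m : ℝ) = (s m : ℝ) ^ 2 * k m := by exact_mod_cast h2
    have h8 : (0 : ℝ) ≤ k m := by positivity
    nlinarith
  have hlt : ∀ m ∈ J.filter (fun m => ∃ s, S ≤ s ∧ s ^ 2 ∣ m),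
      ∀ m' ∈ J.filter (fun m => ∃ s, S ≤ s ∧ s ^ 2 ∣ m), k m = k m' → ¬ s m < s m' := by
    intro m hm m' hm' hk hlt
    obtain ⟨h1, h2, h3, h4, h5⟩ := hs m hm
    obtain ⟨-, h2', -, -, h5'⟩ := hs m' hm'
    rw [← hk] at h2'
    have e1 : (m : ℝ) = (s m : ℝ) ^ 2 * k m := by exact_mod_cast h2
    have e2 : (m' : ℝ) = (s m' : ℝ) ^ 2 * k m := by exact_mod_cast h2'
    have e3 : (s m : ℝ) + 1 ≤ s m' := by exact_mod_cast hlt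
    have e4 : (1 : ℝ) ≤ k m := by exact_mod_cast h3
    have e5 : (0 : ℝ) ≤ s m := by positivity
    have e6 : √x < s m * k m := by
      rw [sqrt_lt' (by
        have : (0 : ℝ) < s m := by
          rcases eq_or_lt_of_le e5 with h | h
          · rw [← h] at e1; norm_num at e1; rw [e1] at h4; norm_num at h4; linarith
          · exact h
        positivity)]
      calc x < m := h4
        _ = (s m : ℝ) ^ 2 * k m * 1 := by rw [e1, mul_one]
        _ ≤ (s m : ℝ) ^ 2 * k m * k m := by gcongr
        _ = _ := by ring
    have e7 : ((s m : ℝ) + 1) ^ 2 * k m ≤ (s m' : ℝ) ^ 2 * k m := by gcongr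
    nlinarith
  have hinj : Set.InjOn k (J.filter (fun m => ∃ s, S ≤ s ∧ s ^ 2 ∣ m) : Finset ℕ) := by
    intro m hm m' hm' hk
    have h1 := hlt m hm m' hm' hk
    have h2 := hlt m' hm' m hm hk.symm
    have h3 : s m = s m' := by omega
    rw [(hs m hm).2.1, (hs m' hm').2.1, h3, hk]
  have hcard := card_le_card_of_injOn k hmaps hinj
  rw [Nat.card_Ioc, Nat.sub_zero] at hcard
  calc _ ≤ (⌊(x + y) / (S : ℝ) ^ 2⌋₊ : ℝ) := by exact_mod_cast hcard
    _ ≤ _ := Nat.floor_le (by positivity)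

open Classical in
-- For s ≤ S₁ count multiples of s², at most y/s² + 1 each; beyond S₁ the terms +1 would be too many
-- and the injectivity bound takes over.
theorem card_filter_exists_sq_dvd_le {x y : ℝ} (hx : 1 ≤ x) (hy : 0 ≤ y) (hyx : y ≤ √x)
    {S₀ S₁ : ℕ} (hS₀ : 1 ≤ S₀) :
    (((Ioc ⌊x⌋₊ ⌊x + y⌋₊).filter (fun m => ∃ s, S₀ ≤ s ∧ s ^ 2 ∣ m)).card : ℝ) ≤
      2 * y / S₀ + S₁ + (x + y) / ((S₁ : ℝ) + 1) ^ 2 := by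
  set J := Ioc ⌊x⌋₊ ⌊x + y⌋₊ with hJ
  have hsub : J.filter (fun m => ∃ s, S₀ ≤ s ∧ s ^ 2 ∣ m) ⊆
      ((Ioo (S₀ - 1) (S₁ + 1)).biUnion fun s => J.filter (s ^ 2 ∣ ·)) ∪
        J.filter (fun m => ∃ s, S₁ + 1 ≤ s ∧ s ^ 2 ∣ m) := by
    intro m hm
    obtain ⟨h1, s, h2, h3⟩ := mem_filter.1 hm
    rw [mem_union]
    rcases Nat.lt_or_ge s (S₁ + 1) with h | h
    · left
      exact mem_biUnion.2 ⟨s, mem_Ioo.2 ⟨by omega, h⟩, mem_filter.2 ⟨h1, h3⟩⟩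
    · right
      exact mem_filter.2 ⟨h1, s, h, h3⟩
  have h1 := card_le_card hsub
  have h2 := h1.trans (card_union_le _ _)
  have h3 : ((((Ioo (S₀ - 1) (S₁ + 1)).biUnion fun s => J.filter (s ^ 2 ∣ ·)).card : ℕ) : ℝ) ≤
      2 * y / S₀ + S₁ := by
    calc _ ≤ ∑ s ∈ Ioo (S₀ - 1) (S₁ + 1), ((J.filter (s ^ 2 ∣ ·)).card : ℝ) := by
          exact_mod_cast card_biUnion_le
      _ ≤ ∑ s ∈ Ioo (S₀ - 1) (S₁ + 1), (y * ((s : ℝ) ^ 2)⁻¹ + 1) := by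
          refine sum_le_sum fun s _ => ?_
          have := card_Ioc_filter_dvd_le (X := x) (Y := x + y) (by linarith) (by linarith) (s ^ 2)
          rw [add_sub_cancel_left] at this
          push_cast at this
          exact this
      _ = y * ∑ s ∈ Ioo (S₀ - 1) (S₁ + 1), ((s : ℝ) ^ 2)⁻¹ + (S₁ + 1 - (S₀ - 1) - 1 : ℕ) := by
          rw [sum_add_distrib, ← mul_sum, sum_const, Nat.card_Ioo, nsmul_eq_mul, mul_one]
      _ ≤ y * (2 / S₀) + S₁ := by
          have h4 := sum_Ioo_inv_sq_le (α := ℝ) (S₀ - 1) (S₁ + 1)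
          have h5 : ((S₀ - 1 : ℕ) : ℝ) + 1 = S₀ := by
            exact_mod_cast Nat.sub_add_cancel hS₀
          rw [h5] at h4
          gcongr
          omega
      _ = _ := by ring
  have h6 := card_filter_exists_sq_dvd_of_large_le hx hy hyx (S := S₁ + 1) (by omega)
  push_cast at h6
  calc _ ≤ ((((Ioo (S₀ - 1) (S₁ + 1)).biUnion fun s => J.filter (s ^ 2 ∣ ·)).card : ℕ) : ℝ) +
        ((J.filter (fun m => ∃ s, S₁ + 1 ≤ s ∧ s ^ 2 ∣ m)).card : ℝ) := by exact_mod_cast h2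
    _ ≤ _ := by linarith

/-- For q = p^k with k ≥ 2 take s = p^⌊k/2⌋, since 2⌊k/2⌋ ≤ k ≤ 3⌊k/2⌋. -/
theorem exists_sq_dvd_of_isPrimePow {q m : ℕ} (hq : IsPrimePow q) (hnp : ¬ q.Prime) (hqm : q ∣ m) :
    ∃ s, q ≤ s ^ 3 ∧ s ^ 2 ∣ m := by
  obtain ⟨p, k, hp, hk, rfl⟩ := (isPrimePow_nat_iff _).1 hq
  have hk2 : 2 ≤ k := by
    by_contra h
    have : k = 1 := by omega
    rw [this, pow_one] at hnp
    exact hnp hp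
  refine ⟨p ^ (k / 2), ?_, ?_⟩
  · rw [← pow_mul]
    exact Nat.pow_le_pow_right hp.pos (by omega)
  · rw [← pow_mul]
    exact (pow_dvd_pow p (by omega)).trans hqm

theorem card_filter_div_prime_le {x y : ℝ} (hx : 0 ≤ x) (hy : 0 ≤ y) {n : ℕ} (hn : 0 < n) :
    ((Ioc ⌊x⌋₊ ⌊x + y⌋₊).filter (fun m => n ∣ m ∧ (m / n).Prime)).card ≤
      ((Ioc ⌊x / n⌋₊ ⌊(x + y) / n⌋₊).filter Nat.Prime).card := by
  have hn0 : (0 : ℝ) < n := by exact_mod_cast hn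
  refine card_le_card_of_injOn (· / n) ?_ ?_
  · intro m hm
    obtain ⟨h1, h2, h3⟩ := mem_filter.1 hm
    obtain ⟨k, rfl⟩ := h2
    rw [Nat.mul_div_cancel_left _ hn] at h3
    rw [mem_Ioc] at h1
    have h4 : x < (n * k : ℕ) := Nat.lt_of_floor_lt h1.1
    have h5 : ((n * k : ℕ) : ℝ) ≤ x + y := (Nat.le_floor_iff (by linarith)).1 h1.2
    push_cast at h4 h5
    simp only [coe_filter, mem_Ioc, Set.mem_ofPred_eq, Nat.mul_div_cancel_left _ hn]
    refine ⟨⟨?_, ?_⟩, h3⟩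
    · rw [Nat.floor_lt (by positivity), div_lt_iff₀ hn0]; linarith
    · apply Nat.le_floor
      rw [le_div_iff₀ hn0]; linarith
  · intro m hm m' hm' h
    have h1 := (mem_filter.1 hm).2.1
    have h2 := (mem_filter.1 hm').2.1
    dsimp only at h
    rw [← Nat.mul_div_cancel' h1, h, Nat.mul_div_cancel' h2]

open Classical in
-- Splits log m = Σ Λ(q) at q = y. An m with a large square divisor is paid for in full; otherwise
-- each q > y with Λ(q) ≠ 0 is prime and is indexed by its cofactor n = m/q. When n > y the prime is
-- at most (x + y)/y, hence the smaller weight.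
theorem log_le_of_mem_Ioc {x y : ℝ} (hx : 1 ≤ x) (hy : 1 ≤ y) {b m : ℕ} (hb : (x + y) / y ≤ b)
    (hm : x < m) (hm' : (m : ℝ) ≤ x + y) {S₀ : ℕ} (hS₀ : ∀ s : ℕ, ⌊y⌋₊ < s ^ 3 → S₀ ≤ s) :
    log m ≤ (∑ q ∈ Ioc 0 ⌊y⌋₊, if q ∣ m then ArithmeticFunction.vonMangoldt q else 0) +
      (if ∃ s, S₀ ≤ s ∧ s ^ 2 ∣ m then log (x + y) else 0) +
      (∑ n ∈ Icc 1 ⌊y⌋₊, if n ∣ m ∧ (m / n).Prime then log (x + y) else 0) +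
      ∑ n ∈ Ico (⌊y⌋₊ + 1) b, if n ∣ m ∧ (m / n).Prime then log ((x + y) / y) else 0 := by
  have hm0 : (0 : ℝ) < m := by linarith
  have hm1 : 0 < m := by exact_mod_cast hm0
  have hlog1 : 0 ≤ log (x + y) := log_nonneg (by linarith)
  have hlog2 : 0 ≤ log ((x + y) / y) := log_nonneg (by rw [le_div_iff₀ (by linarith)]; linarith)
  set Y := ⌊y⌋₊ with hY
  have hYy : y < (Y : ℝ) + 1 := Nat.lt_floor_add_one y
  have i1 : 0 ≤ ∑ q ∈ Ioc 0 Y, (if q ∣ m then ArithmeticFunction.vonMangoldt q else 0) := by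
    refine sum_nonneg fun q _ => ?_
    split_ifs
    · exact ArithmeticFunction.vonMangoldt_nonneg
    · exact le_rfl
  have i2 : 0 ≤ ∑ n ∈ Icc 1 Y, (if n ∣ m ∧ (m / n).Prime then log (x + y) else 0) :=
    sum_nonneg fun n _ => by split_ifs <;> simp [hlog1]
  have i3 : 0 ≤ ∑ n ∈ Ico (Y + 1) b, (if n ∣ m ∧ (m / n).Prime then log ((x + y) / y) else 0) :=
    sum_nonneg fun n _ => by split_ifs <;> simp [hlog2]
  by_cases hbad : ∃ s, S₀ ≤ s ∧ s ^ 2 ∣ m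
  · rw [if_pos hbad]
    have := log_le_log hm0 hm'
    linarith
  rw [if_neg hbad, add_zero, ← ArithmeticFunction.vonMangoldt_sum,
    ← sum_filter_add_sum_filter_not m.divisors (fun q => q ≤ Y), add_assoc]
  refine add_le_add ?_ ?_
  · rw [← sum_filter]
    refine sum_le_sum_of_subset_of_nonneg ?_ fun _ _ _ => ArithmeticFunction.vonMangoldt_nonneg
    intro q hq
    simp only [mem_filter, Nat.mem_divisors] at hq
    rw [mem_filter, mem_Ioc]
    exact ⟨⟨Nat.pos_of_dvd_of_pos hq.1.1 hm1, hq.2⟩, hq.1.1⟩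
  · set F := m.divisors.filter (fun q => ¬ q ≤ Y ∧ q.Prime) with hF
    have h1 : ∑ q ∈ m.divisors with ¬ q ≤ Y, ArithmeticFunction.vonMangoldt q =
        ∑ q ∈ F, log q := by
      rw [hF, ← filter_filter, sum_filter (fun q : ℕ => Nat.Prime q)]
      refine sum_congr rfl fun q hq => ?_
      simp only [mem_filter, Nat.mem_divisors] at hq
      split_ifs with hp
      · exact ArithmeticFunction.vonMangoldt_apply_prime hp
      · by_contra hne
        obtain ⟨s, hs1, hs2⟩ := exists_sq_dvd_of_isPrimePow
          (ArithmeticFunction.vonMangoldt_ne_zero_iff.1 hne) hp hq.1.1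
        exact hbad ⟨s, hS₀ s (by omega), hs2⟩
    rw [h1, ← sum_filter_add_sum_filter_not F (fun q => m / q ≤ Y)]
    have hFm : ∀ q ∈ F, q ∣ m ∧ Y < q ∧ q.Prime ∧ m / (m / q) = q ∧ m / q ∣ m ∧ 0 < m / q ∧
        ((m / q : ℕ) : ℝ) * q = m := by
      intro q hq
      simp only [hF, mem_filter, Nat.mem_divisors, not_le] at hq
      refine ⟨hq.1.1, hq.2.1, hq.2.2, Nat.div_div_self hq.1.1 (by omega),
        Nat.div_dvd_of_dvd hq.1.1, Nat.div_pos (Nat.le_of_dvd hm1 hq.1.1) hq.2.2.pos, ?_⟩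
      exact_mod_cast Nat.div_mul_cancel hq.1.1
    have hinj : ∀ G ⊆ F, Set.InjOn (fun q => m / q) (G : Set ℕ) := by
      intro G hG q hq q' hq' h
      dsimp only at h
      rw [← (hFm q (hG hq)).2.2.2.1, h, (hFm q' (hG hq')).2.2.2.1]
    refine add_le_add ?_ ?_
    · rw [← sum_filter]
      calc ∑ q ∈ F with m / q ≤ Y, log (q : ℝ) ≤ ∑ q ∈ F with m / q ≤ Y, log (x + y) := by
            refine sum_le_sum fun q hq => ?_
            have h2 := hFm q (mem_filter.1 hq).1
            refine log_le_log (by exact_mod_cast h2.2.2.1.pos) (le_trans ?_ hm')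
            exact_mod_cast Nat.le_of_dvd hm1 h2.1
        _ = ∑ n ∈ (F.filter fun q => m / q ≤ Y).image (m / ·), log (x + y) :=
            (sum_image (f := fun _ => log (x + y)) (hinj _ (filter_subset _ _))).symm
        _ ≤ _ := by
            refine sum_le_sum_of_subset_of_nonneg ?_ fun _ _ _ => hlog1
            intro n hn
            obtain ⟨q, hq, rfl⟩ := mem_image.1 hn
            obtain ⟨hq1, hq2⟩ := mem_filter.1 hq
            have h2 := hFm q hq1
            rw [mem_filter, mem_Icc]
            exact ⟨⟨h2.2.2.2.2.2.1, hq2⟩, h2.2.2.2.2.1, by rw [h2.2.2.2.1]; exact h2.2.2.1⟩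
    · rw [← sum_filter]
      calc ∑ q ∈ F with ¬ m / q ≤ Y, log (q : ℝ)
          ≤ ∑ q ∈ F with ¬ m / q ≤ Y, log ((x + y) / y) := by
            refine sum_le_sum fun q hq => ?_
            obtain ⟨hq1, hq2⟩ := mem_filter.1 hq
            have h2 := hFm q hq1
            refine log_le_log (by exact_mod_cast h2.2.2.1.pos) ?_
            rw [le_div_iff₀ (by linarith)]
            have h3 : (Y : ℝ) + 1 ≤ (m / q : ℕ) := by exact_mod_cast not_le.1 hq2
            have h4 := h2.2.2.2.2.2.2
            have h5 : (0 : ℝ) ≤ q := by positivity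
            nlinarith
        _ = ∑ n ∈ (F.filter fun q => ¬ m / q ≤ Y).image (m / ·), log ((x + y) / y) :=
            (sum_image (f := fun _ => log ((x + y) / y)) (hinj _ (filter_subset _ _))).symm
        _ ≤ _ := by
            refine sum_le_sum_of_subset_of_nonneg ?_ fun _ _ _ => hlog2
            intro n hn
            obtain ⟨q, hq, rfl⟩ := mem_image.1 hn
            obtain ⟨hq1, hq2⟩ := mem_filter.1 hq
            have h2 := hFm q hq1
            rw [mem_filter, mem_Ico]
            refine ⟨⟨by omega, ?_⟩, h2.2.2.2.2.1, by rw [h2.2.2.2.1]; exact h2.2.2.1⟩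
            have h3 : (Y : ℝ) + 1 ≤ q := by exact_mod_cast h2.2.1
            have h4 := h2.2.2.2.2.2.2
            have h6 : (0 : ℝ) < (m / q : ℕ) := by exact_mod_cast h2.2.2.2.2.2.1
            have h5 : ((m / q : ℕ) : ℝ) < (x + y) / y := by
              rw [lt_div_iff₀ (by linarith)]
              nlinarith
            exact_mod_cast h5.trans_le hb

/-- The logarithms of the integers of a short interval, estimated through their prime factors. -/
theorem sub_one_mul_log_le {x y : ℝ} (hx : 1 ≤ x) (hy : 1 ≤ y) (hyx : y ≤ √x) {b S₀ S₁ : ℕ}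
    (hb : (x + y) / y ≤ b) (hS₀ : ∀ s : ℕ, ⌊y⌋₊ < s ^ 3 → S₀ ≤ s) (hS₀' : 1 ≤ S₀) :
    (y - 1) * log x ≤ y * log y + 2 * (log 4 + 4) * y +
      log (x + y) * (2 * y / S₀ + S₁ + (x + y) / ((S₁ : ℝ) + 1) ^ 2) +
      log (x + y) * (∑ n ∈ Icc 1 ⌊y⌋₊,
        (((Ioc ⌊x / n⌋₊ ⌊(x + y) / n⌋₊).filter Nat.Prime).card : ℝ)) +
      log ((x + y) / y) * ∑ n ∈ Ico (⌊y⌋₊ + 1) b,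
        (((Ioc ⌊x / n⌋₊ ⌊(x + y) / n⌋₊).filter Nat.Prime).card : ℝ) := by
  classical
  set J := Ioc ⌊x⌋₊ ⌊x + y⌋₊ with hJ
  have hJm : ∀ m ∈ J, x < m ∧ (m : ℝ) ≤ x + y := by
    intro m hm
    rw [hJ, mem_Ioc] at hm
    exact ⟨Nat.lt_of_floor_lt hm.1, (Nat.le_floor_iff (by linarith)).1 hm.2⟩
  have hlogx : 0 ≤ log x := log_nonneg hx
  have hlog1 : 0 ≤ log (x + y) := log_nonneg (by linarith)
  have hlog2 : 0 ≤ log ((x + y) / y) := log_nonneg (by rw [le_div_iff₀ (by linarith)]; linarith)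
  have hlow : (y - 1) * log x ≤ ∑ m ∈ J, log m := by
    have h1 : ∀ m ∈ J, log x ≤ log m := fun m hm => log_le_log (by linarith) (hJm m hm).1.le
    have h2 := card_nsmul_le_sum J _ _ h1
    rw [nsmul_eq_mul] at h2
    refine le_trans ?_ h2
    gcongr
    rw [hJ, Nat.card_Ioc, Nat.cast_sub (Nat.floor_le_floor (by linarith))]
    have h3 := Nat.floor_le (by linarith : 0 ≤ x)
    have h4 := Nat.lt_floor_add_one (x + y)
    linarith
  refine hlow.trans ((sum_le_sum fun m hm =>
    log_le_of_mem_Ioc hx hy hb (hJm m hm).1 (hJm m hm).2 hS₀).trans ?_)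
  rw [sum_add_distrib, sum_add_distrib, sum_add_distrib]
  have hY1 : 1 ≤ ⌊y⌋₊ := Nat.le_floor (by simpa using hy)
  have hYle : (⌊y⌋₊ : ℝ) ≤ y := Nat.floor_le (by linarith)
  have hswap : ∀ (s : Finset ℕ) (L : ℝ), 0 ≤ L → (∀ n ∈ s, 0 < n) →
      ∑ m ∈ J, ∑ n ∈ s, (if n ∣ m ∧ (m / n).Prime then L else 0) ≤
        L * ∑ n ∈ s, (((Ioc ⌊x / n⌋₊ ⌊(x + y) / n⌋₊).filter Nat.Prime).card : ℝ) := by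
    intro s L hL hs
    rw [sum_comm, mul_sum]
    refine sum_le_sum fun n hn => ?_
    rw [← sum_filter, sum_const, nsmul_eq_mul, mul_comm]
    refine mul_le_mul_of_nonneg_left ?_ hL
    exact_mod_cast card_filter_div_prime_le (by linarith) (by linarith) (hs n hn)
  refine add_le_add (add_le_add (add_le_add ?_ ?_) ?_) ?_
  · rw [sum_comm]
    calc ∑ q ∈ Ioc 0 ⌊y⌋₊, ∑ m ∈ J, (if q ∣ m then ArithmeticFunction.vonMangoldt q else 0)
        ≤ ∑ q ∈ Ioc 0 ⌊y⌋₊, ArithmeticFunction.vonMangoldt q * (y / q + 1) := by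
          refine sum_le_sum fun q _ => ?_
          rw [← sum_filter, sum_const, nsmul_eq_mul, mul_comm]
          refine mul_le_mul_of_nonneg_left ?_ ArithmeticFunction.vonMangoldt_nonneg
          have := card_Ioc_filter_dvd_le (X := x) (Y := x + y) (by linarith) (by linarith) q
          rwa [add_sub_cancel_left] at this
      _ = y * ∑ q ∈ Ioc 0 ⌊y⌋₊, ArithmeticFunction.vonMangoldt q / q + Chebyshev.psi y := by
          rw [Chebyshev.psi, mul_sum, ← sum_add_distrib]
          exact sum_congr rfl fun q _ => by ring
      _ ≤ y * (log y + (log 4 + 4)) + (log 4 + 4) * y := by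
          have h1 := sum_vonMangoldt_div_le hY1
          have h2 := Chebyshev.psi_le_const_mul_self (by linarith : 0 ≤ y)
          have h3 : log (⌊y⌋₊ : ℝ) ≤ log y := log_le_log (by exact_mod_cast hY1) hYle
          gcongr
          linarith
      _ = _ := by ring
  · rw [← sum_filter, sum_const, nsmul_eq_mul, mul_comm]
    refine mul_le_mul_of_nonneg_left ?_ hlog1
    exact card_filter_exists_sq_dvd_le hx (by linarith) hyx hS₀'
  · exact hswap _ _ hlog1 fun n hn => (mem_Icc.1 hn).1
  · exact hswap _ _ hlog2 fun n hn => by have := (mem_Ico.1 hn).1; omega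

end ShortIntervals

/-! ### The middle range, the error terms, and the conclusion. -/

section Main

open Finset Real Filter

theorem primePi_sub_primePi {X Y : ℝ} (h : X ≤ Y) :
    (primePi Y : ℝ) - primePi X = ((Ioc ⌊X⌋₊ ⌊Y⌋₊).filter Nat.Prime).card := by
  have h1 : ⌊X⌋₊ ≤ ⌊Y⌋₊ := Nat.floor_le_floor h
  have h2 : primePi X + ((Ioc ⌊X⌋₊ ⌊Y⌋₊).filter Nat.Prime).card = primePi Y := by
    rw [primePi, primePi, Nat.primeCounting, Nat.primeCounting, Nat.primeCounting',
      Nat.count_eq_card_filter_range, Nat.count_eq_card_filter_range, ← card_union_of_disjoint]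
    · rw [← filter_union]
      congr 2
      ext n
      simp only [mem_union, mem_range, mem_Ioc]
      omega
    · refine disjoint_filter_filter (disjoint_left.2 fun n hn hn' => ?_)
      rw [mem_range] at hn
      rw [mem_Ioc] at hn'
      omega
  rw [← h2]
  push_cast
  ring

theorem sum_Ico_one_div_le_log {Y : ℕ} (hY : 1 ≤ Y) (b : ℕ) (hb : 1 ≤ (b : ℝ) / Y) :
    ∑ n ∈ Ico (Y + 1) b, (1 : ℝ) / n ≤ log (b / Y) := by
  have hY0 : (0 : ℝ) < Y := by exact_mod_cast hY
  have key : ∀ k : ℕ, ∑ n ∈ Ico (Y + 1) (Y + 1 + k), (1 : ℝ) / n ≤ log (Y + k) - log Y := by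
    intro k
    induction k with
    | zero => simp
    | succ k ih =>
      rw [← add_assoc, sum_Ico_succ_top (by omega)]
      have hk : (0 : ℝ) < Y + k := by positivity
      have h1 := one_sub_inv_le_log_of_pos (x := ((Y : ℝ) + k + 1) / (Y + k)) (by positivity)
      rw [log_div (by positivity) hk.ne'] at h1
      have h2 : 1 - (((Y : ℝ) + k + 1) / (Y + k))⁻¹ = 1 / ((Y + 1 + k : ℕ) : ℝ) := by
        push_cast
        rw [inv_div, show (Y : ℝ) + 1 + k = Y + k + 1 by ring]
        field_simp
        ring
      rw [h2] at h1
      push_cast at h1 ih ⊢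
      rw [← add_assoc]
      linarith
  rcases Nat.lt_or_ge b (Y + 1) with h | h
  · rw [Ico_eq_empty_of_le (by omega), sum_empty]
    exact log_nonneg hb
  · obtain ⟨k, rfl⟩ := Nat.exists_eq_add_of_le h
    refine (key k).trans ?_
    rw [log_div (by positivity) hY0.ne']
    have : log ((Y : ℝ) + k) ≤ log ((Y + 1 + k : ℕ) : ℝ) := by
      apply log_le_log (by positivity)
      push_cast; linarith
    linarith

theorem log_div_le_selbergDenom {x : ℝ} (hx : 1 ≤ x) :
    log x / 14 ≤ selbergDenom ⌊x ^ (1 / 14 : ℝ)⌋₊ := by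
  set R := ⌊x ^ (1 / 14 : ℝ)⌋₊
  have h1 := log_add_one_le_harmonic R
  have h2 : ((harmonic R : ℚ) : ℝ) = ∑ n ∈ Icc 1 R, (1 : ℝ) / n := by
    rw [harmonic_eq_sum_Icc]
    push_cast
    simp
  have h3 : log x / 14 ≤ log ((R + 1 : ℕ) : ℝ) := by
    calc log x / 14 = log (x ^ (1 / 14 : ℝ)) := by rw [log_rpow (by linarith)]; ring
      _ ≤ _ := by
        apply log_le_log (by positivity)
        push_cast
        exact (Nat.lt_floor_add_one _).le
  rw [h2] at h1
  exact h3.trans (h1.trans (sum_inv_le_selbergDenom R))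

/-- The sifted sum in the middle range, with explicit logarithmic error terms. -/
theorem exists_sum_card_primes_middle_le : ∃ C : ℝ, 1 ≤ C ∧ ∀ lam α x : ℝ, α = (1 - lam) / 2 →
    0 < lam → lam < 1 / 29 → 1 ≤ x → 1 ≤ log x → 2 * C * (log x + 1) ≤ x ^ (1 / 1000 : ℝ) →
    ∑ n ∈ Ico (⌊x ^ α⌋₊ + 1) ⌈(x + x ^ α) / x ^ α⌉₊,
      (((Ioc ⌊x / n⌋₊ ⌊(x + x ^ α) / n⌋₊).filter Nat.Prime).card : ℝ) ≤
      x ^ α * (14 * (lam * log x + 5) / log x) + x ^ α / (log x + 1) := by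
  obtain ⟨C, hC, h⟩ := exists_sum_card_primes_le
  refine ⟨C + 5, by linarith, ?_⟩
  intro lam α x hα hlam0 hlam hx hL hCL
  have hx0 : 0 < x := by linarith
  set L := log x with hLdef
  have hpow : ∀ {p q : ℝ}, p ≤ q → x ^ p ≤ x ^ q := fun h => rpow_le_rpow_of_exponent_le hx h
  set y := x ^ α with hy
  have hy1 : 1 ≤ y := one_le_rpow hx (by linarith)
  have hyx : y ≤ x := by simpa using hpow (by linarith : α ≤ 1)
  have hxy : x / y = x ^ (1 - α) := by rw [hy, rpow_sub hx0, rpow_one]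
  set Y := ⌊y⌋₊ with hY
  have hY1 : 1 ≤ Y := Nat.le_floor (by simpa using hy1)
  have hYlt : y < (Y : ℝ) + 1 := Nat.lt_floor_add_one y
  have hYhalf : y / 2 ≤ Y := by
    have : (1 : ℝ) ≤ Y := by exact_mod_cast hY1
    linarith
  set b := ⌈(x + y) / y⌉₊ with hb
  have hdiv : (x + y) / y = x ^ (1 - α) + 1 := by rw [add_div, hxy, div_self (by positivity)]
  have hb1 : (b : ℝ) ≤ 3 * x ^ (1 - α) := by
    have h1 : (b : ℝ) ≤ (x + y) / y + 1 :=
      (Nat.ceil_lt_add_one (by positivity : 0 ≤ (x + y) / y)).le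
    have h2 : 1 ≤ x ^ (1 - α) := one_le_rpow hx (by linarith)
    linarith
  have hb2 : (b : ℝ) ≤ 3 * x ^ (15 / 29 : ℝ) :=
    hb1.trans (by gcongr ?_ * ?_; exact hpow (by linarith))
  have h3x : (3 : ℝ) ≤ x ^ (1 / 1000 : ℝ) := by nlinarith
  have hbx : (b : ℝ) ≤ x := by
    calc (b : ℝ) ≤ x ^ (1 / 1000 : ℝ) * x ^ (15 / 29 : ℝ) := hb2.trans (by gcongr)
      _ = x ^ (1 / 1000 + 15 / 29 : ℝ) := (rpow_add hx0 _ _).symm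
      _ ≤ x ^ (1 : ℝ) := hpow (by norm_num)
      _ = x := rpow_one x
  set R := ⌊x ^ (1 / 14 : ℝ)⌋₊ with hR
  have hR1 : 1 ≤ R := Nat.le_floor (by simpa using one_le_rpow hx (by norm_num))
  have hRx : (R : ℝ) ≤ x ^ (1 / 14 : ℝ) := Nat.floor_le (by positivity)
  -- The number of dyadic blocks: 2^k ≥ e^L = x ≥ b because log 2 > 1/2.
  set k := ⌈2 * L⌉₊ with hk
  have hkL : (k : ℝ) ≤ 2 * (L + 1) := by
    have : (k : ℝ) ≤ 2 * L + 1 := (Nat.ceil_lt_add_one (by linarith : 0 ≤ 2 * L)).le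
    linarith
  have hbk : b ≤ 2 ^ k * (Y + 1) := by
    have h1 : b ≤ 2 ^ k := by
      have h2 : (b : ℝ) ≤ 2 ^ (k : ℝ) := by
        calc (b : ℝ) ≤ x := hbx
          _ = exp L := (exp_log hx0).symm
          _ ≤ exp (log 2 * k) := by
              apply exp_le_exp.2
              have h1 := Nat.le_ceil (2 * L)
              have h2 := log_two_gt_d9
              have h3 : 0 ≤ 2 * L := by linarith
              nlinarith
          _ = 2 ^ (k : ℝ) := (rpow_def_of_pos (by norm_num) _).symm
      rw [rpow_natCast] at h2
      exact_mod_cast h2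
    exact h1.trans (Nat.le_mul_of_pos_right _ (by omega))
  have hmain := h x y hx (by linarith) hyx (Y + 1) b R k
    (by
      push_cast
      exact (hpow (by linarith : (14 / 29 : ℝ) ≤ α)).trans hYlt.le)
    hb2 hbk hR1 hRx
    (by
      intro n hn
      rw [mem_Ico] at hn
      have hn0 : (0 : ℝ) < n := by exact_mod_cast (by omega : 0 < n)
      have hnb : (n : ℝ) ≤ b := by exact_mod_cast hn.2.le
      rw [le_div_iff₀ hn0]
      calc (R : ℝ) * n ≤ x ^ (1 / 14 : ℝ) * (x ^ (1 / 1000 : ℝ) * x ^ (15 / 29 : ℝ)) := by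
            gcongr
            exact hnb.trans (hb2.trans (by gcongr))
        _ = x ^ (1 / 14 + (1 / 1000 + 15 / 29) : ℝ) := by
            rw [← rpow_add hx0, ← rpow_add hx0]
        _ ≤ x ^ (1 : ℝ) := hpow (by norm_num)
        _ = x := rpow_one x)
  refine hmain.trans (add_le_add ?_ ?_)
  · have hH : ∑ n ∈ Ico (Y + 1) b, (1 : ℝ) / n ≤ lam * L + 5 := by
      have hY0 : (0 : ℝ) < Y := by exact_mod_cast hY1
      have hYy : (Y : ℝ) ≤ y := Nat.floor_le (by linarith)
      have h1 : 1 ≤ (b : ℝ) / Y := by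
        rw [one_le_div hY0]
        calc (Y : ℝ) ≤ x ^ α := hYy
          _ ≤ x ^ (1 - α) := hpow (by linarith)
          _ ≤ (x + y) / y := by rw [hdiv]; linarith
          _ ≤ b := Nat.le_ceil _
      refine (sum_Ico_one_div_le_log hY1 b h1).trans ?_
      calc log (b / Y) ≤ log (3 * x ^ (1 - α) / (y / 2)) := by
            apply log_le_log (by linarith)
            gcongr
        _ = log (6 * x ^ lam) := by
            congr 1
            have : x ^ lam = x ^ (1 - α) / y := by
              rw [hy, ← rpow_sub hx0]; congr 1; rw [hα]; ring
            rw [this]; field_simp; norm_num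
        _ = log 6 + lam * L := by rw [log_mul (by norm_num) (by positivity), log_rpow hx0]
        _ ≤ lam * L + 5 := by
            have := log_le_sub_one_of_pos (by norm_num : (0 : ℝ) < 6)
            linarith
    have hden : L / 14 ≤ selbergDenom R := log_div_le_selbergDenom hx
    calc y * (∑ n ∈ Ico (Y + 1) b, (1 : ℝ) / n) / selbergDenom R
        ≤ y * (lam * L + 5) / (L / 14) := by gcongr
      _ = _ := by field_simp
  · rw [le_div_iff₀ (by linarith)]
    have hR2 : (R : ℝ) ^ 2 ≤ x ^ (1 / 7 : ℝ) := by
      calc (R : ℝ) ^ 2 ≤ (x ^ (1 / 14 : ℝ)) ^ 2 := by gcongr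
        _ = x ^ (1 / 7 : ℝ) := by rw [← rpow_natCast, ← rpow_mul hx0.le]; norm_num
    have hL0 : 0 ≤ L + 1 := by linarith
    -- The logarithms cost x^(1/500), and 1/500 + 1/7 + 337/1000 is still below 14/29 < α.
    have hsq : 4 * C * (L + 1) ^ 2 ≤ x ^ (1 / 500 : ℝ) := by
      calc 4 * C * (L + 1) ^ 2 ≤ (2 * (C + 5) * (L + 1)) ^ 2 := by
            have : 4 * C ≤ (2 * (C + 5)) ^ 2 := by nlinarith
            rw [mul_pow]
            gcongr
        _ ≤ (x ^ (1 / 1000 : ℝ)) ^ 2 := by gcongr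
        _ = x ^ (1 / 500 : ℝ) := by rw [← rpow_natCast, ← rpow_mul hx0.le]; norm_num
    calc (R : ℝ) ^ 2 * (2 * (k * (C * x ^ (337 / 1000 : ℝ)))) * (L + 1)
        ≤ x ^ (1 / 7 : ℝ) * (2 * (2 * (L + 1) * (C * x ^ (337 / 1000 : ℝ)))) * (L + 1) := by
          gcongr
      _ = (4 * C * (L + 1) ^ 2) * (x ^ (1 / 7 : ℝ) * x ^ (337 / 1000 : ℝ)) := by ring
      _ ≤ x ^ (1 / 500 : ℝ) * (x ^ (1 / 7 : ℝ) * x ^ (337 / 1000 : ℝ)) := by gcongr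
      _ = x ^ (1 / 500 + (1 / 7 + 337 / 1000) : ℝ) := by rw [← rpow_add hx0, ← rpow_add hx0]
      _ ≤ x ^ α := hpow (by rw [hα]; linarith)

/-- The contribution of the integers divisible by a large square is negligible. -/
theorem square_error_le {α x : ℝ} (hα1 : 14 / 29 < α) (hα2 : α ≤ 1 / 2)
    (hx : 1 ≤ x) (hL : 5 * (log x + 1) ≤ x ^ (1 / 1000 : ℝ)) :
    (log x + 1) * (2 * x ^ α / ⌈(x ^ α) ^ (1 / 3 : ℝ)⌉₊ + ⌊x ^ (2 / 5 : ℝ)⌋₊ +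
      (x + x ^ α) / ((⌊x ^ (2 / 5 : ℝ)⌋₊ : ℝ) + 1) ^ 2) ≤ x ^ α := by
  have hx0 : 0 < x := by linarith
  have hL0 : 0 ≤ log x := log_nonneg hx
  have hpow : ∀ {p q : ℝ}, p ≤ q → x ^ p ≤ x ^ q := fun h => rpow_le_rpow_of_exponent_le hx h
  have h1 : 2 * x ^ α / ⌈(x ^ α) ^ (1 / 3 : ℝ)⌉₊ ≤ 2 * x ^ (α - 1 / 1000) := by
    have h2 := Nat.le_ceil ((x ^ α) ^ (1 / 3 : ℝ))
    calc 2 * x ^ α / ⌈(x ^ α) ^ (1 / 3 : ℝ)⌉₊ ≤ 2 * x ^ α / (x ^ α) ^ (1 / 3 : ℝ) := by gcongr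
      _ = 2 * x ^ (α - α * (1 / 3)) := by
          rw [← rpow_mul hx0.le, rpow_sub hx0]; ring
      _ ≤ 2 * x ^ (α - 1 / 1000) := by
          gcongr 2 * ?_
          exact hpow (by linarith)
  have h2 : (⌊x ^ (2 / 5 : ℝ)⌋₊ : ℝ) ≤ x ^ (α - 1 / 1000) :=
    (Nat.floor_le (by positivity)).trans (hpow (by linarith))
  have h3 : (x + x ^ α) / ((⌊x ^ (2 / 5 : ℝ)⌋₊ : ℝ) + 1) ^ 2 ≤ 2 * x ^ (α - 1 / 1000) := by
    have h4 := (Nat.lt_floor_add_one (x ^ (2 / 5 : ℝ))).le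
    have h5 : x ^ α ≤ x := by simpa using hpow (by linarith : α ≤ 1)
    calc (x + x ^ α) / ((⌊x ^ (2 / 5 : ℝ)⌋₊ : ℝ) + 1) ^ 2
        ≤ (x + x) / (x ^ (2 / 5 : ℝ)) ^ 2 := by gcongr
      _ = 2 * x ^ (1 / 5 : ℝ) := by
          rw [← rpow_natCast, ← rpow_mul hx0.le,
            show (1 / 5 : ℝ) = 1 - 2 / 5 * (2 : ℕ) by norm_num, rpow_sub hx0, rpow_one]
          ring
      _ ≤ 2 * x ^ (α - 1 / 1000) := by
          gcongr 2 * ?_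
          exact hpow (by linarith)
  calc _ ≤ (log x + 1) * (2 * x ^ (α - 1 / 1000) + x ^ (α - 1 / 1000) +
        2 * x ^ (α - 1 / 1000)) := by gcongr
    _ = (5 * (log x + 1)) * x ^ (α - 1 / 1000) := by ring
    _ ≤ x ^ (1 / 1000 : ℝ) * x ^ (α - 1 / 1000) := by gcongr
    _ = x ^ α := by rw [← rpow_add hx0]; ring_nf

/-- Here (1 + λ)/2 = 1 - α, so the factor bounds log((x + y)/y); the product of the main terms is (1
+ λ)/2 · 14λ · L. -/
theorem mul_le_of_le_sieve_bound {lam y L M : ℝ} (h0 : 0 < lam) (h1 : lam < 1 / 29) (hL : 1 ≤ L)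
    (hy : 0 ≤ y) (hM : M ≤ y * (14 * (lam * L + 5) / L) + y / (L + 1)) :
    ((1 + lam) / 2 * L + 1) * M ≤ y * (7 * lam * (1 + lam) * L + 170) := by
  have hL0 : 0 < L := by linarith
  have c1 : ((1 + lam) / 2 * L + 1) * (14 * (lam * L + 5) / L) ≤
      7 * lam * (1 + lam) * L + 160 := by
    rw [mul_div_assoc', div_le_iff₀ hL0]
    have e1 : lam * L ≤ L := mul_le_of_le_one_left hL0.le (by linarith)
    have e2 : 0 ≤ L * (L - 1) := by nlinarith
    linarith
  have c2 : ((1 + lam) / 2 * L + 1) * (y / (L + 1)) ≤ y := by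
    rw [mul_div_assoc', div_le_iff₀ (by linarith), mul_comm]
    gcongr
    nlinarith
  calc ((1 + lam) / 2 * L + 1) * M
      ≤ ((1 + lam) / 2 * L + 1) * (y * (14 * (lam * L + 5) / L) + y / (L + 1)) := by gcongr
    _ = y * (((1 + lam) / 2 * L + 1) * (14 * (lam * L + 5) / L)) +
        ((1 + lam) / 2 * L + 1) * (y / (L + 1)) := by ring
    _ ≤ y * (7 * lam * (1 + lam) * L + 160) + y := by gcongr
    _ ≤ _ := by linarith

theorem mainTheorem5 (lam α : ℝ) (hlam₁ : 1 / 33 < lam) (hlam₂ : lam < 1 / 29)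
    (hα : α = (1 - lam) / 2) (ε : ℝ) (hε : 0 < ε) :
    ∃ x₀ : ℝ, ∀ x : ℝ, x₀ ≤ x →
      (1 / 4 + lam / 2 - ε) * x ^ α ≤
        ∑ n ∈ Finset.Icc 1 ⌊x ^ α⌋₊,
          ((primePi ((x + x ^ α) / (n : ℝ)) : ℝ) - (primePi (x / (n : ℝ)) : ℝ)) := by
  obtain ⟨C, hC, hmid⟩ := exists_sum_card_primes_middle_le
  set κ := (1 + lam) / 2 - 7 * lam * (1 + lam) - (1 / 4 + lam / 2) with hκ
  -- The claim is 7λ(1 + λ) < 1/4; at λ = 1/29 the left side is 210/841.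
  have hκ0 : 0 < κ := by nlinarith
  set K := 2 * (log 4 + 4) + 200 with hK
  have hev : ∀ᶠ x : ℝ in atTop, 1 ≤ x ∧ 2 * (C + 5) * (log x + 1) ≤ x ^ (1 / 1000 : ℝ) ∧
      (1 + K) / κ ≤ log x ∧ 1 ≤ log x := by
    have h1 : ∀ᶠ x : ℝ in atTop, log x ≤ 1 / (4 * (C + 5)) * x ^ (1 / 1000 : ℝ) := by
      have h2 := (isLittleO_log_rpow_atTop (by norm_num : (0 : ℝ) < 1 / 1000)).bound
        (by positivity : 0 < 1 / (4 * (C + 5)))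
      filter_upwards [h2, eventually_ge_atTop 1] with x hx hx1
      rwa [norm_of_nonneg (log_nonneg hx1), norm_of_nonneg (by positivity)] at hx
    filter_upwards [h1, eventually_ge_atTop 1, tendsto_log_atTop.eventually_ge_atTop 1,
      tendsto_log_atTop.eventually_ge_atTop ((1 + K) / κ)] with x h2 h3 h4 h5
    refine ⟨h3, ?_, h5, h4⟩
    have h6 : 4 * (C + 5) * log x ≤ x ^ (1 / 1000 : ℝ) := by
      rw [div_mul_eq_mul_div, one_mul, le_div_iff₀ (by positivity)] at h2
      linarith
    nlinarith
  obtain ⟨x₀, hx₀⟩ := eventually_atTop.1 hev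
  refine ⟨x₀, fun x hxx => ?_⟩
  obtain ⟨hx, hCL, hLbig, hL⟩ := hx₀ x hxx
  have hx0 : 0 < x := by linarith
  have hpow : ∀ {p q : ℝ}, p ≤ q → x ^ p ≤ x ^ q := fun h => rpow_le_rpow_of_exponent_le hx h
  have hM := hmid lam α x hα (by linarith) hlam₂ hx hL (by nlinarith)
  have hsq := square_error_le (α := α) (by linarith) (by linarith) hx (by nlinarith)
  have hLdef : log (x ^ α) = α * log x := log_rpow hx0 α
  set L := log x with hL'
  have hLy : L ≤ x ^ α := by
    have h1 : x ^ (1 / 1000 : ℝ) ≤ x ^ α := hpow (by linarith)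
    nlinarith
  set y := x ^ α with hy
  have hy1 : 1 ≤ y := one_le_rpow hx (by linarith)
  have hyx : y ≤ x := by simpa using hpow (by linarith : α ≤ 1)
  have hysqrt : y ≤ √x := by rw [sqrt_eq_rpow]; exact hpow (by linarith)
  have hS₀ : ∀ s : ℕ, ⌊y⌋₊ < s ^ 3 → ⌈y ^ (1 / 3 : ℝ)⌉₊ ≤ s := by
    intro s hs
    apply Nat.ceil_le.2
    have h1 : y < (s : ℝ) ^ 3 := by
      have := Nat.lt_of_floor_lt hs
      exact_mod_cast this
    calc y ^ (1 / 3 : ℝ) ≤ ((s : ℝ) ^ 3) ^ (1 / 3 : ℝ) := by gcongr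
      _ = s := by
          rw [← rpow_natCast, ← rpow_mul (by positivity)]; norm_num
  -- With S₁ ≈ x^(2/5), both S₁ and x/S₁² are smaller than y by a power of x.
  have hmain := sub_one_mul_log_le hx hy1 hysqrt (b := ⌈(x + y) / y⌉₊) (S₁ := ⌊x ^ (2 / 5 : ℝ)⌋₊)
    (Nat.le_ceil _) hS₀ (Nat.one_le_ceil_iff.2 (by positivity))
  have hT : ∑ n ∈ Icc 1 ⌊y⌋₊, ((primePi ((x + y) / (n : ℝ)) : ℝ) - (primePi (x / (n : ℝ)) : ℝ)) =
      ∑ n ∈ Icc 1 ⌊y⌋₊, (((Ioc ⌊x / n⌋₊ ⌊(x + y) / n⌋₊).filter Nat.Prime).card : ℝ) :=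
    sum_congr rfl fun n _ => primePi_sub_primePi (by gcongr; linarith)
  rw [hT]
  rw [hLdef] at hmain
  set T := ∑ n ∈ Icc 1 ⌊y⌋₊, (((Ioc ⌊x / n⌋₊ ⌊(x + y) / n⌋₊).filter Nat.Prime).card : ℝ)
  set M := ∑ n ∈ Ico (⌊y⌋₊ + 1) ⌈(x + y) / y⌉₊,
    (((Ioc ⌊x / n⌋₊ ⌊(x + y) / n⌋₊).filter Nat.Prime).card : ℝ)
  set E := 2 * y / ⌈y ^ (1 / 3 : ℝ)⌉₊ + ⌊x ^ (2 / 5 : ℝ)⌋₊ +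
    (x + y) / ((⌊x ^ (2 / 5 : ℝ)⌋₊ : ℝ) + 1) ^ 2
  have hT0 : 0 ≤ T := sum_nonneg fun _ _ => Nat.cast_nonneg _
  have hM0 : 0 ≤ M := sum_nonneg fun _ _ => Nat.cast_nonneg _
  have hE0 : 0 ≤ E := by positivity
  have hlog2 : log 2 ≤ 1 := by have := log_two_lt_d9; linarith
  have hl1 : log (x + y) ≤ L + 1 := by
    calc log (x + y) ≤ log (2 * x) := log_le_log (by linarith) (by linarith)
      _ = log 2 + L := log_mul (by norm_num) hx0.ne'
      _ ≤ L + 1 := by linarith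
  have hl2 : log ((x + y) / y) ≤ (1 + lam) / 2 * L + 1 := by
    rw [log_div (by positivity) (by positivity), hLdef, hα]
    linarith
  have b1 : log (x + y) * E ≤ y := (mul_le_mul_of_nonneg_right hl1 hE0).trans hsq
  have b2 : log (x + y) * T ≤ (L + 1) * T := mul_le_mul_of_nonneg_right hl1 hT0
  have b3 : log ((x + y) / y) * M ≤ y * (7 * lam * (1 + lam) * L + 170) :=
    (mul_le_mul_of_nonneg_right hl2 hM0).trans
      (mul_le_of_le_sieve_bound (by linarith) hlam₂ hL (by linarith) hM)
  rw [div_le_iff₀ hκ0] at hLbig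
  -- The surplus κ y L ≥ (1 + K) y absorbs every O(y) term, so the bound is reached even without the
  -- loss ε.
  have hfin : (1 / 4 + lam / 2) * y * (L + 1) ≤ T * (L + 1) := by
    have d1 : y * L - y ≤ (y - 1) * L := by rw [sub_mul]; linarith
    have d2 : y * (1 + K) ≤ y * (L * κ) := by gcongr
    have d3 : y * lam ≤ y * 1 := by gcongr; linarith
    rw [hα] at hmain
    rw [hκ, hK] at d2
    clear_value T M E
    linarith
  have h1 := le_of_mul_le_mul_right hfin (by linarith)
  have h2 : 0 ≤ ε * y := by positivity
  linarith

end Main
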